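/- Let $G=(V,E)$ be an infinite, connected, locally finite graph which is quasi-transitive (the orbit space $V/\mathrm{Aut}(G)$ is finite) and unimodular (that is, $\mathrm{Aut}(G)$, with the topology of pointwise convergence, is a unimodular group). Let $\langle U(e);\,e\in E\rangle$ be independent uniform $[0,1]$ random variables. An extended path joining two vertices $a,b$ is either a simple path from $a$ to $b$, or the union of an infinite simple path starting at $a$ and a disjoint infinite simple path starting at $b$. The wired minimal spanning forest $\mathfrak F_w$ (with law WMSF) is the spanning subgraph of $G$ formed by the edges $e$ such that every extended path joining the endpoints of $e$ contains an edge $e'$ with $U(e')\ge U(e)$. For $p\in[0,1]$ let $G[p]$ be the spanning subgraph with edge set $\{e : U(e)<p\}$ (Bernoulli$(p)$ bond percolation), let $\theta(p,G,v)$ be the probability that the vertex $v$ is in an infinite connected component of $G[p]$, and let $p_c=p_c(G)$ be the infimum of the $p\in[0,1]$ such that $G[p]$ has an infinite connected component almost surely. An end of a tree is an equivalence class of infinite simple paths in it, two such paths being equivalent if their symmetric difference is finite. Then: 1. If $G$ is transitive, then for every vertex $x$ the expected degree of $x$ in $\mathfrak F_w$ is $2$. 2. If $\theta(p_c,G,o)=0$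 for some vertex $o$, then almost surely every connected component of $\mathfrak F_w$ has exactly one end. -/

import Mathlib

open MeasureTheory
open scoped ENNReal

noncomputable section

namespace MinimalForest

universe u

variable {V : Type u}

/-! ### Transitivity and unimodularity -/

/-- Any two vertices are related by an automorphism of the graph. -/
def IsTransitive (G : SimpleGraph V) : Prop :=
  ∀ x y : V, ∃ φ : G ≃g G, φ x = y

/-- Two vertices are equivalent if they lie in the same orbit of the automorphism group. -/
def orbitSetoid (G : SimpleGraph V) : Setoid V where
  r x y := ∃ φ : G ≃g G, φ x = y
  iseqv :=
    { refl := fun x => ⟨RelIso.refl _, rfl⟩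
      symm := by
        rintro x y ⟨φ, rfl⟩
        exact ⟨φ.symm, φ.symm_apply_apply x⟩
      trans := by
        rintro x y z ⟨φ, rfl⟩ ⟨ψ, rfl⟩
        exact ⟨φ.trans ψ, rfl⟩ }

/-- The orbit space of the automorphism group acting on the vertices is finite. -/
def IsQuasiTransitive (G : SimpleGraph V) : Prop :=
  Finite (Quotient (orbitSetoid G))

/-- The topology of pointwise convergence on `Aut(G)`, the vertex set being discrete. -/
@[reducible] def autTopology (G : SimpleGraph V) : TopologicalSpace (G ≃g G) :=
  TopologicalSpace.induced (fun φ : G ≃g G => (φ : V → V))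
    (@Pi.topologicalSpace V (fun _ => V) (fun _ => ⊥))

/-- `Aut(G)` is a unimodular group: it carries a (left) Haar measure, on its Borel sets, that is
also invariant under right multiplication. -/
def IsUnimodular (G : SimpleGraph V) : Prop :=
  letI : TopologicalSpace (G ≃g G) := autTopology G
  letI : MeasurableSpace (G ≃g G) := borel (G ≃g G)
  ∃ μ : Measure (G ≃g G), μ.IsHaarMeasure ∧ μ.IsMulRightInvariant

/-! ### Infinite simple paths and ends -/

/-- An infinite simple path, given by its successive vertices. -/
structure Ray (T : SimpleGraph V) where
  vert : ℕ → V
  injective : Function.Injective vert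
  adj : ∀ n, T.Adj (vert n) (vert (n + 1))

/-- The vertices of an infinite simple path. -/
def Ray.support {T : SimpleGraph V} (r : Ray T) : Set V := Set.range r.vert

/-- The edges of an infinite simple path. -/
def Ray.edges {T : SimpleGraph V} (r : Ray T) : Set T.edgeSet :=
  Set.range fun n => (⟨s(r.vert n, r.vert (n + 1)), r.adj n⟩ : T.edgeSet)

/-- Two infinite simple paths are equivalent if their symmetric difference is finite. -/
def raySetoid (T : SimpleGraph V) : Setoid (Ray T) where
  r r₁ r₂ := (symmDiff r₁.support r₂.support).Finite
  iseqv :=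
    { refl := fun r => by simp
      symm := fun {r s} h => by rwa [symmDiff_comm]
      trans := fun {r s t} h₁ h₂ =>
        (h₁.union h₂).subset (symmDiff_triangle r.support s.support t.support) }

/-- The ends of a tree: equivalence classes of infinite simple paths. -/
def TreeEnd (T : SimpleGraph V) : Type u := Quotient (raySetoid T)

/-! ### The wired minimal spanning forest -/

/-- `P` is the edge set of an extended path joining `a` and `b`: a simple path from `a` to `b`, or
the union of an infinite simple path starting at `a` and a disjoint infinite simple path starting
at `b`. -/
def IsExtendedPath (G : SimpleGraph V) (a b : V) (P : Set G.edgeSet) : Prop :=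
  (∃ p : G.Walk a b, p.IsPath ∧ P = {e : G.edgeSet | (e : Sym2 V) ∈ p.edges}) ∨
  (∃ r s : Ray G, r.vert 0 = a ∧ s.vert 0 = b ∧ Disjoint r.support s.support ∧
    P = r.edges ∪ s.edges)

/-- Labelings of the edges by elements of `[0, 1]`. -/
abbrev Labeling (G : SimpleGraph V) : Type u := G.edgeSet → unitInterval

/-- The law of independent uniform `[0, 1]` labels on the edges. -/
def labelMeasure (G : SimpleGraph V) : Measure (Labeling G) :=
  Measure.infinitePi fun _ : G.edgeSet => (volume : Measure unitInterval)

/-- The edges `e` such that every extended path joining the endpoints of `e` contains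
an edge `e'` with `U e' ≥ U e`. -/
def wiredEdges (G : SimpleGraph V) (U : Labeling G) : Set G.edgeSet :=
  {e | ∀ a b : V, (e : Sym2 V) = s(a, b) → ∀ P : Set G.edgeSet, IsExtendedPath G a b P →
    ∃ e' ∈ P, U e ≤ U e'}

/-- The wired minimal spanning forest of the labeling `U`, as a spanning subgraph. When `U` has
law `labelMeasure G`, its law is the WMSF of `G`. -/
def wiredForest (G : SimpleGraph V) (U : Labeling G) : SimpleGraph V :=
  SimpleGraph.fromEdgeSet (Subtype.val '' wiredEdges G U)

/-- The expected degree of the vertex `x` in the wired minimal spanning forest. -/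
def wiredExpectedDegree (G : SimpleGraph V) (x : V) : ℝ≥0∞ :=
  ∫⁻ U, (((wiredForest G U).neighborSet x).encard : ℝ≥0∞) ∂(labelMeasure G)

/-! ### Bernoulli bond percolation -/

/-- `G[p]`: the spanning subgraph of the edges with label less than `p`. When `U` has law
`labelMeasure G` and `0 ≤ p ≤ 1`, each edge is kept independently with probability `p`. -/
def percolation (G : SimpleGraph V) (U : Labeling G) (p : ℝ) : SimpleGraph V :=
  SimpleGraph.fromEdgeSet (Subtype.val '' {e : G.edgeSet | (U e : ℝ) < p})

/-- The probability that `v` is in an infinite cluster of `G[p]`. -/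
def theta (G : SimpleGraph V) (p : ℝ) (v : V) : ℝ≥0∞ :=
  labelMeasure G {U | ((percolation G U p).connectedComponentMk v).supp.Infinite}

/-- The critical probability: the infimum of the `p` in `[0, 1]` such that `G[p]` has an infinite
connected component almost surely. -/
def criticalProbability (G : SimpleGraph V) : ℝ :=
  sInf {p : ℝ | p ∈ Set.Icc (0 : ℝ) 1 ∧
    ∀ᵐ U ∂(labelMeasure G), ∃ C : (percolation G U p).ConnectedComponent, C.supp.Infinite}

end MinimalForest

end

/-!
The wired minimal spanning forest is governed by the *ponds* of the labeling. The bottleneck `Z(x)`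
of a vertex `x` is the level at which its percolation cluster becomes infinite, and the pond of `x`
is its cluster at level `Z(x)`. Ponds partition the vertices. An edge of the forest either joins two
vertices of one pond, or it is the outlet of exactly one finite pond, that is, the unique boundary
edge whose label is the bottleneck of that pond (`outlet_or_outlet`, `pond_finite_of_label_eq`,
`bottleneck_lt_of_outlet`). The outlet leads to a pond of smaller bottleneck. Inside a finite cluster
the forest is a spanning tree (`isTree_induce_cluster`). These facts hold for labelings in general
position (`IsGeneric`), and rest on the description of the forest in terms of clusters in
`wiredForest_adj_iff`, which uses König's lemma.

*Expected degree.* A finite pond with `k` vertices owns `k` forest edges: its `k - 1` tree edges and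
its outlet. Hence sharing the incidences of these edges equally within the pond gives every vertex
the amount `2`, and by the mass transport principle the expected degree is `2`. An infinite pond is
exhausted by finite clusters with `k` vertices and `k - 1` tree edges, and the error `2 / k` vanishes
in the limit. This needs no information about percolation at the critical level.

*One end.* Suppose that all ponds are finite. Following each vertex to the outlet of its pond defines
a parent map whose edges are exactly the forest edges (`exists_parent`), and components have one end
as soon as every vertex has finitely many descendants (`card_treeEnd_eq_one`). Since bottlenecks
strictly decrease from pond to pond, if a vertex has infinitely many descendants, then infinitely many
vertices cross some rational level at one vertex of its pond (`finite_flow`); as every vertex crosses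
a level at most once, this is excluded by mass transport (`ae_isTame`).

*Ponds are finite.* If there is no percolation at the critical level, an infinite pond has its
bottleneck strictly above a level `q` at which infinite clusters exist. Opening a path from the pond
to such a cluster, which is allowed by insertion tolerance, makes infinitely many vertices cross a
level at one vertex, which has just been excluded (`false_of_lowered`).
-/

noncomputable section

namespace MinimalForest

universe u

variable {V : Type u} {G : SimpleGraph V}

/-! ### Infinite clusters contain infinite simple paths -/

/-- The vertices that can be reached from `x` inside the graph `H`. -/
def reachSet (H : SimpleGraph V) (x : V) : Set V := {y | H.Reachable x y}

theorem mem_reachSet_self (H : SimpleGraph V) (x : V) : x ∈ reachSet H x :=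
  SimpleGraph.Reachable.refl x

theorem reachSet_eq_of_reachable {H : SimpleGraph V} {x y : V} (h : H.Reachable x y) :
    reachSet H x = reachSet H y := by
  ext z
  exact ⟨fun hz => h.symm.trans hz, fun hz => h.trans hz⟩

theorem reachSet_mono {H H' : SimpleGraph V} (h : H ≤ H') (x : V) : reachSet H x ⊆ reachSet H' x :=
  fun _ hy => SimpleGraph.Reachable.mono h hy

/-- A set that contains `x` and is closed under adjacency contains the component of `x`. -/
theorem reachSet_subset {H : SimpleGraph V} {x : V} {S : Set V} (hx : x ∈ S)
    (hS : ∀ y z, y ∈ S → H.Adj y z → z ∈ S) : reachSet H x ⊆ S := by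
  intro y hy
  have hy' : H.Reachable x y := hy
  rw [SimpleGraph.reachable_iff_reflTransGen] at hy'
  induction hy' with
  | refl => exact hx
  | tail h1 h2 ih =>
    exact hS _ _ (ih ((SimpleGraph.reachable_iff_reflTransGen _ _).2 h1)) h2

/-- A path from inside `S` to outside `S` leaves `S` along an edge whose inner endpoint is reachable. -/
theorem exists_adj_of_reachable {H : SimpleGraph V} {x y : V} {S : Set V} (h : H.Reachable x y)
    (hx : x ∈ S) (hy : y ∉ S) : ∃ a b, a ∈ S ∧ b ∉ S ∧ H.Adj a b ∧ H.Reachable x a := by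
  by_contra! hcon
  have : reachSet H x ⊆ {z | z ∈ S ∧ H.Reachable x z} := by
    refine reachSet_subset ⟨hx, .refl _⟩ fun a b ha hab => ?_
    refine ⟨?_, ha.2.trans hab.reachable⟩
    by_contra hb
    exact hcon a b ha.1 hb hab ha.2
  exact hy (this h).1

/-- The vertices `z` such that some geodesic from `a` to `z` passes through `v`. -/
def geodesicCone (H : SimpleGraph V) (a v : V) : Set V :=
  {z | H.Reachable v z ∧ H.dist a z = H.dist a v + H.dist v z}

theorem exists_geodesicCone_infinite {H : SimpleGraph V} (hfin : ∀ v, (H.neighborSet v).Finite)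
    {a v : V} (hav : H.Reachable a v) (hinf : (geodesicCone H a v).Infinite) :
    ∃ w, H.Adj v w ∧ H.dist a w = H.dist a v + 1 ∧ (geodesicCone H a w).Infinite := by
  by_contra! hcon
  have hsub : geodesicCone H a v ⊆ {v} ∪ ⋃ w ∈ {w | H.Adj v w ∧ H.dist a w = H.dist a v + 1},
      geodesicCone H a w := by
    rintro z ⟨hz, hd⟩
    by_cases hzv : z = v
    · exact Or.inl hzv
    right
    obtain ⟨p, hp⟩ := hz.exists_walk_length_eq_dist
    cases p with
    | nil => exact absurd rfl hzv
    | @cons _ w _ hadj q =>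
      have hl : H.dist v z = q.length + 1 := by rw [← hp]; rfl
      have h1 : H.dist w z ≤ q.length := SimpleGraph.dist_le q
      have h3 : H.dist a w ≤ H.dist a v + 1 := by
        obtain ⟨r, hr⟩ := hav.exists_walk_length_eq_dist
        have := SimpleGraph.dist_le (r.concat hadj)
        rw [SimpleGraph.Walk.length_concat, hr] at this
        exact this
      have h4 : H.dist a z ≤ H.dist a w + H.dist w z := by
        obtain ⟨r, hr⟩ := (hav.trans hadj.reachable).exists_walk_length_eq_dist
        obtain ⟨s, hs⟩ := (q.reachable).exists_walk_length_eq_dist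
        have := SimpleGraph.dist_le (r.append s)
        rw [SimpleGraph.Walk.length_append, hr, hs] at this
        exact this
      simp only [Set.mem_iUnion]
      exact ⟨w, ⟨hadj, by omega⟩, q.reachable, by omega⟩
  refine hinf (Set.Finite.subset ?_ hsub)
  refine (Set.finite_singleton v).union (Set.Finite.biUnion ?_ ?_)
  · exact (hfin v).subset fun w hw => hw.1
  · rintro w ⟨h1, h2⟩
    exact hcon w h1 h2

/-- König's lemma: an infinite locally finite component contains an infinite simple path from any
of its vertices. -/
theorem exists_ray {H : SimpleGraph V} (hfin : ∀ v, (H.neighborSet v).Finite) {a : V}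
    (hinf : (reachSet H a).Infinite) : ∃ r : Ray H, r.vert 0 = a := by
  classical
  let S := {v : V // H.Reachable a v ∧ (geodesicCone H a v).Infinite}
  have hstep : ∀ v : S, ∃ w : S, H.Adj v.1 w.1 ∧ H.dist a w.1 = H.dist a v.1 + 1 := by
    rintro ⟨v, hv, hi⟩
    obtain ⟨w, h1, h2, h3⟩ := exists_geodesicCone_infinite hfin hv hi
    exact ⟨⟨w, hv.trans h1.reachable, h3⟩, h1, h2⟩
  choose nxt hadj hdist using hstep
  have ha : (geodesicCone H a a).Infinite := by
    refine hinf.mono fun z hz => ⟨hz, by simp⟩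
  let v0 : S := ⟨a, .refl _, ha⟩
  let s : ℕ → S := fun n => nxt^[n] v0
  have hs : ∀ n, s (n + 1) = nxt (s n) := fun n => Function.iterate_succ_apply' nxt n v0
  have hd : ∀ n, H.dist a (s n).1 = n := by
    intro n
    induction n with
    | zero => exact SimpleGraph.dist_self
    | succ n ih => rw [hs, hdist, ih]
  refine ⟨⟨fun n => (s n).1, fun m n hmn => ?_, fun n => ?_⟩, rfl⟩
  · have := congrArg (H.dist a) hmn
    simpa [hd] using this
  · rw [hs]; exact hadj _

/-! ### Percolation clusters and the wired forest -/

theorem percolation_adj {U : Labeling G} {p : ℝ} {x y : V} :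
    (percolation G U p).Adj x y ↔ ∃ h : G.Adj x y, (U ⟨s(x, y), h⟩ : ℝ) < p := by
  simp only [percolation, SimpleGraph.fromEdgeSet_adj, Set.mem_image, Set.mem_ofPred_eq,
    Subtype.exists, exists_and_right, exists_eq_right]
  exact ⟨fun h => h.1, fun ⟨h, h'⟩ => ⟨⟨h, h'⟩, h.ne⟩⟩

theorem percolation_le (U : Labeling G) (p : ℝ) : percolation G U p ≤ G := fun _ _ h =>
  (percolation_adj.1 h).1

theorem percolation_mono (U : Labeling G) {p q : ℝ} (h : p ≤ q) :
    percolation G U p ≤ percolation G U q := fun _ _ h' => by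
  obtain ⟨h1, h2⟩ := percolation_adj.1 h'
  exact percolation_adj.2 ⟨h1, h2.trans_le h⟩

theorem percolation_anti {U U' : Labeling G} (h : ∀ e, U e ≤ U' e) (p : ℝ) :
    percolation G U' p ≤ percolation G U p := fun _ _ h' => by
  obtain ⟨h1, h2⟩ := percolation_adj.1 h'
  exact percolation_adj.2 ⟨h1, lt_of_le_of_lt (h _) h2⟩

theorem percolation_eq_bot (U : Labeling G) {p : ℝ} (h : p ≤ 0) : percolation G U p = ⊥ := by
  ext x y
  simp only [percolation_adj, SimpleGraph.bot_adj, iff_false, not_exists, not_lt]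
  exact fun h' => h.trans (U _).2.1

theorem percolation_eq_top (U : Labeling G) {p : ℝ} (h : 1 < p) : percolation G U p = G := by
  ext x y
  rw [percolation_adj]
  exact ⟨fun h => h.1, fun h' => ⟨h', (U _).2.2.trans_lt h⟩⟩

theorem wiredForest_adj {U : Labeling G} {x y : V} :
    (wiredForest G U).Adj x y ↔ ∃ h : G.Adj x y, (⟨s(x, y), h⟩ : G.edgeSet) ∈ wiredEdges G U := by
  simp only [wiredForest, SimpleGraph.fromEdgeSet_adj, Set.mem_image, Subtype.exists,
    exists_and_right, exists_eq_right]
  exact ⟨fun h => h.1, fun ⟨h, h'⟩ => ⟨⟨h, h'⟩, h.ne⟩⟩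

/-- The set of vertices of the cluster of `x` in `G[t]`. -/
def cluster (U : Labeling G) (t : ℝ) (x : V) : Set V := reachSet (percolation G U t) x

theorem mem_cluster_self (U : Labeling G) (t : ℝ) (x : V) : x ∈ cluster U t x :=
  mem_reachSet_self _ _

theorem cluster_eq {U : Labeling G} {t : ℝ} {x y : V} (h : y ∈ cluster U t x) :
    cluster U t x = cluster U t y := reachSet_eq_of_reachable h

theorem cluster_mono (U : Labeling G) {s t : ℝ} (h : s ≤ t) (x : V) :
    cluster U s x ⊆ cluster U t x := reachSet_mono (percolation_mono U h) x

theorem mem_cluster_symm {U : Labeling G} {t : ℝ} {x y : V} (h : y ∈ cluster U t x) :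
    x ∈ cluster U t y := SimpleGraph.Reachable.symm h

theorem mem_cluster_of_adj {U : Labeling G} {t : ℝ} {x y z : V} (h : y ∈ cluster U t x)
    (hyz : G.Adj y z) (hl : (U ⟨s(y, z), hyz⟩ : ℝ) < t) : z ∈ cluster U t x :=
  SimpleGraph.Reachable.trans h (percolation_adj.2 ⟨hyz, hl⟩ : (percolation G U t).Adj y z).reachable

theorem le_label_of_boundary {U : Labeling G} {t : ℝ} {x y z : V} (h : y ∈ cluster U t x)
    (hz : z ∉ cluster U t x) (hyz : G.Adj y z) : t ≤ (U ⟨s(y, z), hyz⟩ : ℝ) := by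
  by_contra! hl
  exact hz (mem_cluster_of_adj h hyz hl)

/-- Two vertices are joined by an extended path with all labels below `t` if and only if they lie
in the same cluster of `G[t]` or both lie in infinite clusters of `G[t]`. -/
theorem exists_extendedPath_iff (hfin : ∀ v, (G.neighborSet v).Finite) {U : Labeling G} {t : ℝ}
    {x y : V} : (∃ P, IsExtendedPath G x y P ∧ ∀ e ∈ P, (U e : ℝ) < t) ↔
      y ∈ cluster U t x ∨ ((cluster U t x).Infinite ∧ (cluster U t y).Infinite) := by
  classical
  constructor
  · rintro ⟨P, ⟨p, -, rfl⟩ | ⟨r, s, rfl, rfl, -, rfl⟩, hP⟩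
    · left
      refine SimpleGraph.Walk.reachable (p.transfer _ fun e he => ?_)
      induction e with | _ a b =>
      have hab : G.Adj a b := p.edges_subset_edgeSet he
      exact percolation_adj.2 ⟨hab, hP ⟨s(a, b), hab⟩ he⟩
    · right
      have key : ∀ r : Ray G, (∀ e ∈ r.edges, (U e : ℝ) < t) →
          (cluster U t (r.vert 0)).Infinite := by
        intro r hr
        have : ∀ n, r.vert n ∈ cluster U t (r.vert 0) := by
          intro n
          induction n with
          | zero => exact mem_cluster_self _ _ _
          | succ n ih => exact mem_cluster_of_adj ih (r.adj n) (hr _ ⟨n, rfl⟩)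
        exact (Set.infinite_range_of_injective r.injective).mono
          (Set.range_subset_iff.2 this)
      exact ⟨key r fun e he => hP e (Or.inl he), key s fun e he => hP e (Or.inr he)⟩
  · intro h
    by_cases hxy : y ∈ cluster U t x
    · obtain ⟨p, hp⟩ := SimpleGraph.Reachable.exists_isPath hxy
      have hle := percolation_le U t
      refine ⟨_, Or.inl ⟨p.mapLe hle, (SimpleGraph.Walk.isPath_mapLe hle).2 hp, rfl⟩, ?_⟩
      rintro ⟨e, hG⟩ he
      simp only [Set.mem_ofPred_eq, SimpleGraph.Walk.edges_mapLe_eq_edges] at he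
      induction e with | _ a b =>
      have := percolation_adj.1 (p.edges_subset_edgeSet he : (percolation G U t).Adj a b)
      exact this.2
    · obtain ⟨hx, hy⟩ := h.resolve_left hxy
      have hfin' : ∀ v, ((percolation G U t).neighborSet v).Finite := fun v =>
        (hfin v).subset fun w hw => percolation_le U t hw
      obtain ⟨r, hr⟩ := exists_ray hfin' hx
      obtain ⟨s, hs⟩ := exists_ray hfin' hy
      let up : Ray (percolation G U t) → Ray G := fun r =>
        ⟨r.vert, r.injective, fun n => percolation_le U t (r.adj n)⟩
      have hmem : ∀ (r : Ray (percolation G U t)) n, r.vert n ∈ cluster U t (r.vert 0) := by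
        intro r n
        induction n with
        | zero => exact mem_cluster_self _ _ _
        | succ n ih => exact SimpleGraph.Reachable.trans ih (r.adj n).reachable
      refine ⟨_, Or.inr ⟨up r, up s, hr, hs, ?_, rfl⟩, ?_⟩
      · rw [Set.disjoint_left]
        rintro _ ⟨n, rfl⟩ ⟨m, hm⟩
        have h1 := hmem r n
        have h2 := hmem s m
        rw [hr] at h1
        rw [hs] at h2
        have hm' : s.vert m = r.vert n := hm
        rw [hm'] at h2
        exact hxy (SimpleGraph.Reachable.trans h1 (SimpleGraph.Reachable.symm h2))
      · rintro e (⟨n, rfl⟩ | ⟨n, rfl⟩)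
        · exact (percolation_adj.1 (r.adj n)).2
        · exact (percolation_adj.1 (s.adj n)).2

/-- An edge is in the wired minimal spanning forest if and only if, among the edges of smaller
label, its endpoints are in distinct clusters of which at most one is infinite. -/
theorem wiredForest_adj_iff (hfin : ∀ v, (G.neighborSet v).Finite) {U : Labeling G} {x y : V}
    (h : G.Adj x y) : (wiredForest G U).Adj x y ↔
      y ∉ cluster U (U ⟨s(x, y), h⟩) x ∧
      ¬ ((cluster U (U ⟨s(x, y), h⟩) x).Infinite ∧ (cluster U (U ⟨s(x, y), h⟩) y).Infinite) := by
  rw [← not_or, ← exists_extendedPath_iff hfin, wiredForest_adj]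
  constructor
  · rintro ⟨h', hw⟩ ⟨P, hP, hlt⟩
    obtain ⟨e', he', hle⟩ := hw x y rfl P hP
    exact absurd (hlt e' he') (not_lt.2 hle)
  · intro hno
    refine ⟨h, fun a b hab P hP => ?_⟩
    by_contra! hcon
    have hcon' : ∀ e ∈ P, (U e : ℝ) < U ⟨s(x, y), h⟩ := fun e he => hcon e he
    rcases Sym2.eq_iff.1 hab with ⟨rfl, rfl⟩ | ⟨rfl, rfl⟩
    · exact hno ⟨P, hP, hcon'⟩
    · have := (exists_extendedPath_iff hfin (U := U) (t := U ⟨s(x, y), h⟩)).1 ⟨P, hP, hcon'⟩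
      refine hno ((exists_extendedPath_iff hfin).2 ?_)
      exact this.imp mem_cluster_symm And.symm

theorem wiredForest_le (U : Labeling G) : wiredForest G U ≤ G := fun _ _ h =>
  (wiredForest_adj.1 h).1

/-- If the labels are distinct, the wired minimal spanning forest has no cycle: the edge of largest
label in a cycle has its endpoints joined by the remaining edges. -/
theorem wiredForest_isAcyclic (hfin : ∀ v, (G.neighborSet v).Finite) {U : Labeling G}
    (hU : Function.Injective U) : (wiredForest G U).IsAcyclic := by
  classical
  intro v c hc
  have hG : ∀ e ∈ c.edges, e ∈ G.edgeSet := fun e he => by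
    induction e with | _ a b =>
    exact wiredForest_le U (c.edges_subset_edgeSet he : (wiredForest G U).Adj a b)
  have hne : (c.edges.toFinset.attach).Nonempty := by
    rw [Finset.attach_nonempty_iff]
    have := hc.three_le_length
    rw [← SimpleGraph.Walk.length_edges] at this
    obtain ⟨e, he⟩ := List.exists_mem_of_length_pos (show 0 < c.edges.length by omega)
    exact ⟨e, List.mem_toFinset.2 he⟩
  obtain ⟨⟨e, he⟩, -, hmax⟩ := Finset.exists_max_image c.edges.toFinset.attach
    (fun e => U ⟨e.1, hG e.1 (List.mem_toFinset.1 e.2)⟩) hne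
  rw [List.mem_toFinset] at he
  induction e with | _ x y =>
  have hxy : G.Adj x y := hG _ he
  let H := SimpleGraph.fromEdgeSet {e | e ∈ c.edges}
  have hcH : ∀ e ∈ c.edges, e ∈ H.edgeSet := fun e he => by
    induction e with | _ a b =>
    exact (SimpleGraph.fromEdgeSet_adj _).2 ⟨he, (hG _ he : G.Adj a b).ne⟩
  have hreach := (SimpleGraph.adj_and_reachable_delete_edges_iff_exists_cycle (G := H)
    (v := x) (w := y)).2 ⟨v, c.transfer H hcH, hc.transfer hcH, by
      rwa [SimpleGraph.Walk.edges_transfer]⟩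
  have hle : H \ SimpleGraph.fromEdgeSet {s(x, y)} ≤ percolation G U (U ⟨s(x, y), hxy⟩) := by
    intro a b hab
    rw [SimpleGraph.sdiff_adj, SimpleGraph.fromEdgeSet_adj, SimpleGraph.fromEdgeSet_adj] at hab
    have hab1 : s(a, b) ∈ c.edges := hab.1.1
    have hne : s(a, b) ≠ s(x, y) := fun h => hab.2 ⟨h, hab.1.2⟩
    refine percolation_adj.2 ⟨hG _ hab1, ?_⟩
    have h1 := hmax ⟨s(a, b), List.mem_toFinset.2 hab1⟩ (Finset.mem_attach _ _)
    have h2 : U ⟨s(a, b), hG _ hab1⟩ ≠ U ⟨s(x, y), hxy⟩ := fun h =>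
      hne (congrArg Subtype.val (hU h))
    exact (show U _ < U _ from lt_of_le_of_ne h1 h2)
  have hw : (wiredForest G U).Adj x y := c.edges_subset_edgeSet he
  exact ((wiredForest_adj_iff hfin hxy).1 hw).1 (hreach.2.mono hle)

/-- The finite clusters of `G[t]` are connected by those edges of the wired minimal spanning forest
that belong to `G[t]`: across any cut of such a cluster, the edge of smallest label is in the
forest. -/
theorem reachable_wiredForest_of_finite (hfin : ∀ v, (G.neighborSet v).Finite) {U : Labeling G}
    {t : ℝ} {x y : V} (hK : (cluster U t x).Finite) (hy : y ∈ cluster U t x) :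
    (wiredForest G U ⊓ percolation G U t).Reachable x y := by
  classical
  by_contra hcon
  set H := wiredForest G U ⊓ percolation G U t
  set S := reachSet H x
  have hSK : S ⊆ cluster U t x := reachSet_mono inf_le_right x
  -- the edges of `G[t]` across the cut
  let E : Set (V × V) := {p | p.1 ∈ S ∧ p.2 ∈ cluster U t x ∧ p.2 ∉ S ∧
    (percolation G U t).Adj p.1 p.2}
  have hE : E.Finite := (hK.prod hK).subset fun p hp => ⟨hSK hp.1, hp.2.1⟩
  have hEne : E.Nonempty := by
    obtain ⟨a, b, ha, hb, hab, hxa⟩ := exists_adj_of_reachable (S := S) hy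
      (mem_reachSet_self _ _) hcon
    exact ⟨(a, b), ha, hxa.trans hab.reachable, hb, hab⟩
  let lab : V × V → ℝ := fun p => if h : G.Adj p.1 p.2 then U ⟨s(p.1, p.2), h⟩ else 0
  obtain ⟨⟨a, b⟩, ⟨ha, hbK, hbS, hab⟩, hmin⟩ := Set.exists_min_image E lab hE hEne
  obtain ⟨hG, hlt⟩ := percolation_adj.1 hab
  have hsub : cluster U (U ⟨s(a, b), hG⟩) a ⊆ S := by
    refine reachSet_subset ha fun c d hc hcd => ?_
    by_contra hd
    obtain ⟨hG', hlt'⟩ := percolation_adj.1 hcd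
    have hcd' : (percolation G U t).Adj c d := percolation_adj.2 ⟨hG', hlt'.trans hlt⟩
    have := hmin (c, d) ⟨hc, SimpleGraph.Reachable.trans (hSK hc) hcd'.reachable, hd, hcd'⟩
    simp only [lab, hG, hG', dif_pos] at this
    exact absurd this (not_le.2 hlt')
  have hw : (wiredForest G U).Adj a b := by
    rw [wiredForest_adj_iff hfin hG]
    exact ⟨fun h => hbS (hsub h), fun h => h.1 (hK.subset (hsub.trans hSK))⟩
  exact hbS (SimpleGraph.Reachable.trans (show H.Reachable x a from ha)
    (show H.Adj a b from ⟨hw, hab⟩).reachable)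

/-! ### Bottlenecks, ponds and outlets -/

/-- The level at which the cluster of `x` becomes infinite. -/
def bottleneck (U : Labeling G) (x : V) : ℝ := sInf {t : ℝ | (cluster U t x).Infinite}

/-- The pond of `x`: its cluster among the edges with label below its bottleneck. Ponds partition
the vertices. -/
def pond (U : Labeling G) (x : V) : Set V := cluster U (bottleneck U x) x

theorem pos_of_infinite {U : Labeling G} {x : V} {t : ℝ} (h : (cluster U t x).Infinite) : 0 < t := by
  by_contra! ht
  refine h ((Set.finite_singleton x).subset ?_)
  rw [cluster, percolation_eq_bot U ht]
  exact reachSet_subset rfl fun y z _ h => h.elim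

theorem bddBelow_infinite (U : Labeling G) (x : V) :
    BddBelow {t : ℝ | (cluster U t x).Infinite} := ⟨0, fun _ h => (pos_of_infinite h).le⟩

theorem bottleneck_le {U : Labeling G} {x : V} {t : ℝ} (h : (cluster U t x).Infinite) :
    bottleneck U x ≤ t := csInf_le (bddBelow_infinite U x) h

theorem finite_of_lt_bottleneck {U : Labeling G} {x : V} {t : ℝ} (h : t < bottleneck U x) :
    (cluster U t x).Finite := by
  by_contra hc
  exact absurd (bottleneck_le hc) (not_le.2 h)

theorem infinite_of_two [Infinite V] (hconn : G.Connected) (U : Labeling G) (x : V) :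
    (cluster U 2 x).Infinite := by
  have : cluster U 2 x = Set.univ := by
    rw [cluster, percolation_eq_top U (by norm_num)]
    exact Set.eq_univ_of_forall fun y => hconn.preconnected x y
  rw [this]
  exact Set.infinite_univ

theorem infinite_of_bottleneck_lt [Infinite V] (hconn : G.Connected) {U : Labeling G} {x : V} {t : ℝ}
    (h : bottleneck U x < t) : (cluster U t x).Infinite := by
  obtain ⟨s, hs, hst⟩ := exists_lt_of_csInf_lt ⟨2, infinite_of_two hconn U x⟩ h
  exact Set.Infinite.mono (cluster_mono U hst.le x) hs

theorem le_bottleneck [Infinite V] (hconn : G.Connected) {U : Labeling G} {x : V} {t : ℝ}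
    (h : (cluster U t x).Finite) : t ≤ bottleneck U x := by
  by_contra! hc
  exact infinite_of_bottleneck_lt hconn hc h

theorem bottleneck_anti [Infinite V] (hconn : G.Connected) {U U' : Labeling G}
    (h : ∀ e, U e ≤ U' e) (x : V) : bottleneck U x ≤ bottleneck U' x := by
  refine le_of_forall_gt_imp_ge_of_dense fun t ht => bottleneck_le ?_
  exact (infinite_of_bottleneck_lt hconn ht).mono (reachSet_mono (percolation_anti h t) x)

/-- A path is open at some level below any level at which it is open. -/
theorem exists_lt_mem_cluster {U : Labeling G} {t : ℝ} {x y : V} (h : y ∈ cluster U t x) :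
    ∃ s < t, y ∈ cluster U s x := by
  have : cluster U t x ⊆ {y | ∃ s < t, y ∈ cluster U s x} := by
    refine reachSet_subset ⟨t - 1, by linarith, mem_cluster_self _ _ _⟩ ?_
    rintro y z ⟨s, hs, hy⟩ hyz
    obtain ⟨hG, hl⟩ := percolation_adj.1 hyz
    obtain ⟨r, hr1, hr2⟩ := exists_between (max_lt hs hl)
    exact ⟨r, hr2, mem_cluster_of_adj (cluster_mono U ((le_max_left _ _).trans hr1.le) x hy) hG
      ((le_max_right _ _).trans_lt hr1)⟩
  exact this h

/-- Vertices joined at a level below the bottleneck of the first have the same bottleneck. -/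
theorem bottleneck_eq_of_mem_cluster [Infinite V] (hconn : G.Connected) {U : Labeling G} {x y : V}
    {t : ℝ} (ht : t ≤ bottleneck U x) (h : y ∈ cluster U t x) :
    bottleneck U y = bottleneck U x := by
  obtain ⟨s, hs, hy⟩ := exists_lt_mem_cluster h
  have key : ∀ r, s ≤ r → cluster U r x = cluster U r y := fun r hr =>
    cluster_eq (cluster_mono U hr x hy)
  apply le_antisymm
  · refine le_of_forall_gt_imp_ge_of_dense fun r hr => bottleneck_le ?_
    rw [← key r (by linarith)]
    exact infinite_of_bottleneck_lt hconn hr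
  · refine le_of_forall_gt_imp_ge_of_dense fun r hr => ?_
    rcases le_total s r with hsr | hsr
    · refine bottleneck_le ?_
      rw [key r hsr]
      exact infinite_of_bottleneck_lt hconn hr
    · have h1 : (cluster U s y).Infinite :=
        (infinite_of_bottleneck_lt hconn hr).mono (cluster_mono U hsr y)
      rw [← key s le_rfl] at h1
      linarith [bottleneck_le h1]

theorem bottleneck_eq_of_mem_pond [Infinite V] (hconn : G.Connected) {U : Labeling G} {x y : V}
    (h : y ∈ pond U x) : bottleneck U y = bottleneck U x :=
  bottleneck_eq_of_mem_cluster hconn le_rfl h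

theorem pond_eq [Infinite V] (hconn : G.Connected) {U : Labeling G} {x y : V}
    (h : y ∈ pond U x) : pond U y = pond U x := by
  rw [pond, pond, bottleneck_eq_of_mem_pond hconn h]
  exact (cluster_eq h).symm

theorem mem_pond_self (U : Labeling G) (x : V) : x ∈ pond U x := mem_cluster_self _ _ _

open Classical in
/-- Labelings in general position: the labels are distinct, and no label of an edge `e` equals the
bottleneck of a vertex in the labeling where `e` has been made useless by the label `1`. -/
structure IsGeneric (U : Labeling G) : Prop where
  injective : Function.Injective U
  ne_bottleneck : ∀ (e : G.edgeSet) (w : V), (U e : ℝ) ≠ bottleneck (Function.update U e 1) w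

theorem le_update_one [DecidableEq G.edgeSet] (U : Labeling G) (e e' : G.edgeSet) :
    U e' ≤ Function.update U e 1 e' := by
  by_cases h : e' = e
  · subst h; rw [Function.update_self]; exact unitInterval.le_one (U e')
  · rw [Function.update_of_ne h]

/-- The pond of `v` is left through an edge to `w` whose label is the bottleneck of `v`. -/
def PondStep (U : Labeling G) (v w : V) : Prop :=
  ∃ u, u ∈ pond U v ∧ w ∉ pond U v ∧ ∃ h : G.Adj u w, (U ⟨s(u, w), h⟩ : ℝ) = bottleneck U v

theorem eq_of_outlet {U : Labeling G} (hU : Function.Injective U) {S : Set V} {u w u' w' : V}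
    (hu : u ∈ S) (hu' : u' ∈ S) (hw' : w' ∉ S) {h : G.Adj u w} {h' : G.Adj u' w'}
    (heq : (U ⟨s(u, w), h⟩ : ℝ) = U ⟨s(u', w'), h'⟩) : u = u' ∧ w = w' := by
  have h1 := congrArg Subtype.val (hU (Subtype.ext heq))
  rcases Sym2.eq_iff.1 h1 with h2 | ⟨rfl, rfl⟩
  · exact h2
  · exact absurd hu hw'

theorem pondStep_rightUnique {U : Labeling G} (hU : Function.Injective U) :
    Relator.RightUnique (PondStep U) := by
  rintro v w w' ⟨u, hu, hw, _, he⟩ ⟨u', hu', hw', _, he'⟩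
  exact (eq_of_outlet hU hu hu' hw' (he.trans he'.symm)).2

theorem pondStep_congr [Infinite V] (hconn : G.Connected) {U : Labeling G} {v v' w : V}
    (h : v' ∈ pond U v) : PondStep U v' w ↔ PondStep U v w := by
  rw [PondStep, PondStep, pond_eq hconn h, bottleneck_eq_of_mem_pond hconn h]

theorem finite_boundary (hfin : ∀ v, (G.neighborSet v).Finite) {K : Set V} (hK : K.Finite) :
    {p : V × V | p.1 ∈ K ∧ p.2 ∉ K ∧ G.Adj p.1 p.2}.Finite := by
  refine (hK.prod (hK.biUnion fun v _ => hfin v)).subset ?_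
  rintro ⟨a, b⟩ ⟨ha, -, hab⟩
  exact ⟨ha, Set.mem_biUnion ha hab⟩

/-- A finite pond has an outlet. -/
theorem exists_outlet [Infinite V] (hconn : G.Connected) (hfin : ∀ v, (G.neighborSet v).Finite)
    {U : Labeling G} {x : V} (hK : (pond U x).Finite) :
    ∃ u w, u ∈ pond U x ∧ w ∉ pond U x ∧ ∃ h : G.Adj u w, (U ⟨s(u, w), h⟩ : ℝ) = bottleneck U x := by
  classical
  by_contra! hcon
  let lab : V × V → ℝ := fun p => if h : G.Adj p.1 p.2 then U ⟨s(p.1, p.2), h⟩ else 0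
  have hB := finite_boundary hfin hK
  have hlt : ∀ p ∈ {p : V × V | p.1 ∈ pond U x ∧ p.2 ∉ pond U x ∧ G.Adj p.1 p.2},
      bottleneck U x < lab p := by
    rintro ⟨a, b⟩ ⟨ha, hb, hab⟩
    simp only [lab, hab, dif_pos]
    exact lt_of_le_of_ne (le_label_of_boundary ha hb hab) (hcon a b ha hb hab).symm
  obtain ⟨t, ht, hmin⟩ : ∃ t, bottleneck U x < t ∧
      ∀ p ∈ {p : V × V | p.1 ∈ pond U x ∧ p.2 ∉ pond U x ∧ G.Adj p.1 p.2}, t ≤ lab p := by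
    rcases Set.eq_empty_or_nonempty
      {p : V × V | p.1 ∈ pond U x ∧ p.2 ∉ pond U x ∧ G.Adj p.1 p.2} with h | h
    · exact ⟨bottleneck U x + 1, by linarith, fun p hp => by rw [h] at hp; exact hp.elim⟩
    · obtain ⟨p, hp, hmin⟩ := Set.exists_min_image _ lab hB h
      exact ⟨lab p, hlt p hp, hmin⟩
  refine infinite_of_bottleneck_lt hconn ht (hK.subset ?_)
  refine reachSet_subset (mem_pond_self U x) fun a b ha hab => ?_
  by_contra hb
  obtain ⟨hG, hl⟩ := percolation_adj.1 hab
  have := hmin (a, b) ⟨ha, hb, hG⟩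
  simp only [lab, hG, dif_pos] at this
  linarith

/-- The outlet of a finite pond leads to a vertex of smaller bottleneck. -/
theorem bottleneck_lt_of_outlet [Infinite V] (hconn : G.Connected)
    (hfin : ∀ v, (G.neighborSet v).Finite) {U : Labeling G} (hU : IsGeneric U) {x u w : V}
    (hK : (pond U x).Finite) (hu : u ∈ pond U x) (hw : w ∉ pond U x) (h : G.Adj u w)
    (he : (U ⟨s(u, w), h⟩ : ℝ) = bottleneck U x) : bottleneck U w < bottleneck U x := by
  classical
  set e : G.edgeSet := ⟨s(u, w), h⟩ with he_def
  set U' : Labeling G := Function.update U e 1 with hU'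
  let lab : V × V → ℝ := fun p => if h : G.Adj p.1 p.2 then U ⟨s(p.1, p.2), h⟩ else 0
  -- the boundary edges of the pond other than the outlet have labels bounded away from `Z`
  have hB : ({p : V × V | p.1 ∈ pond U x ∧ p.2 ∉ pond U x ∧ G.Adj p.1 p.2} \ {(u, w)}).Finite :=
    (finite_boundary hfin hK).subset Set.sdiff_subset
  have hlt : ∀ p ∈ {p : V × V | p.1 ∈ pond U x ∧ p.2 ∉ pond U x ∧ G.Adj p.1 p.2} \ {(u, w)},
      bottleneck U x < lab p := by
    rintro ⟨a, b⟩ ⟨⟨ha, hb, hab⟩, hne⟩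
    simp only [lab, hab, dif_pos]
    refine lt_of_le_of_ne (le_label_of_boundary ha hb hab) fun heq => hne ?_
    obtain ⟨rfl, rfl⟩ := eq_of_outlet hU.injective hu ha hb (he.trans heq)
    rfl
  obtain ⟨t₀, ht₀, hmin⟩ : ∃ t, bottleneck U x < t ∧
      ∀ p ∈ {p : V × V | p.1 ∈ pond U x ∧ p.2 ∉ pond U x ∧ G.Adj p.1 p.2} \ {(u, w)},
        t ≤ lab p := by
    rcases Set.eq_empty_or_nonempty
      ({p : V × V | p.1 ∈ pond U x ∧ p.2 ∉ pond U x ∧ G.Adj p.1 p.2} \ {(u, w)}) with h | h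
    · exact ⟨bottleneck U x + 1, by linarith, fun p hp => by rw [h] at hp; exact hp.elim⟩
    · obtain ⟨p, hp, hmin⟩ := Set.exists_min_image _ lab hB h
      exact ⟨lab p, hlt p hp, hmin⟩
  have hle : bottleneck U' w ≤ bottleneck U x := by
    refine le_of_forall_gt_imp_ge_of_dense fun r hr => ?_
    set t := min r t₀ with ht
    have htZ : bottleneck U x < t := lt_min hr ht₀
    refine (bottleneck_le (t := t) ?_).trans (min_le_left _ _)
    have hinf := infinite_of_bottleneck_lt hconn htZ
    intro hwfin
    refine hinf ((hwfin.union hK).subset ?_)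
    refine reachSet_subset (Or.inr (mem_pond_self U x)) fun a b ha hab => ?_
    obtain ⟨hG, hl⟩ := percolation_adj.1 hab
    by_cases hb : b ∈ pond U x
    · exact Or.inr hb
    left
    by_cases heq : (⟨s(a, b), hG⟩ : G.edgeSet) = e
    · rcases Sym2.eq_iff.1 (congrArg Subtype.val heq) with ⟨-, h2⟩ | ⟨-, h2⟩
      · rw [h2]; exact mem_cluster_self _ _ _
      · rw [h2] at hb; exact absurd hu hb
    rcases ha with ha | ha
    · refine mem_cluster_of_adj ha hG ?_
      rw [hU', Function.update_of_ne heq]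
      exact hl
    · exfalso
      have hne : (a, b) ≠ (u, w) := by
        rintro h
        obtain ⟨rfl, rfl⟩ := Prod.mk.inj h
        exact heq rfl
      have := hmin (a, b) ⟨⟨ha, hb, hG⟩, hne⟩
      simp only [lab, hG, dif_pos] at this
      exact absurd (this.trans hl.le) (not_le.2 ((min_le_right r t₀).lt_of_ne fun h => by
        rw [← ht] at h; linarith))
  have hne : bottleneck U' w ≠ bottleneck U x := by
    rw [← he]
    have := hU.ne_bottleneck e w
    convert this.symm
  exact (bottleneck_anti hconn (fun e' => le_update_one U e e') w).trans_lt
    (lt_of_le_of_ne hle hne)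

theorem PondStep.bottleneck_lt [Infinite V] (hconn : G.Connected)
    (hfin : ∀ v, (G.neighborSet v).Finite) {U : Labeling G} (hU : IsGeneric U) {v w : V}
    (hK : (pond U v).Finite) (h : PondStep U v w) : bottleneck U w < bottleneck U v := by
  obtain ⟨u, hu, hw, h, he⟩ := h
  exact bottleneck_lt_of_outlet hconn hfin hU hK hu hw h he

/-- The outlet of a finite pond belongs to the wired forest. -/
theorem wiredForest_adj_of_outlet (hfin : ∀ v, (G.neighborSet v).Finite) {U : Labeling G}
    {x u w : V} (hK : (pond U x).Finite) (hu : u ∈ pond U x) (hw : w ∉ pond U x) (h : G.Adj u w)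
    (he : (U ⟨s(u, w), h⟩ : ℝ) = bottleneck U x) : (wiredForest G U).Adj u w := by
  have hcl : cluster U (bottleneck U x) u = pond U x := (cluster_eq hu).symm
  rw [wiredForest_adj_iff hfin h, he, hcl]
  exact ⟨hw, fun h => h.1 hK⟩

/-- If an edge at `x` has the bottleneck of `x` as its label, then the pond of `x` is finite: an
infinite pond would not use that edge, so that the bottleneck of `x` would not depend on its
label. -/
theorem pond_finite_of_label_eq [Infinite V] (hconn : G.Connected) {U : Labeling G}
    (hU : IsGeneric U) {x y : V} (h : G.Adj x y)
    (he : (U ⟨s(x, y), h⟩ : ℝ) = bottleneck U x) : (pond U x).Finite := by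
  classical
  by_contra hinf
  set e : G.edgeSet := ⟨s(x, y), h⟩
  have hle : percolation G U (bottleneck U x) ≤
      percolation G (Function.update U e 1) (bottleneck U x) := by
    intro a b hab
    obtain ⟨hG, hl⟩ := percolation_adj.1 hab
    refine percolation_adj.2 ⟨hG, ?_⟩
    have hne : (⟨s(a, b), hG⟩ : G.edgeSet) ≠ e := fun h => by rw [h] at hl; linarith
    rwa [Function.update_of_ne hne]
  have h1 : bottleneck (Function.update U e 1) x ≤ bottleneck U x :=
    bottleneck_le (Set.Infinite.mono (reachSet_mono hle x) hinf)
  have h2 := bottleneck_anti hconn (fun e' => le_update_one U e e') x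
  have h3 := hU.ne_bottleneck e x
  refine h3 ?_
  rw [he]
  convert le_antisymm h2 h1

/-- An edge of the wired forest between different ponds is the outlet of one of them. -/
theorem outlet_or_outlet [Infinite V] (hconn : G.Connected)
    (hfin : ∀ v, (G.neighborSet v).Finite) {U : Labeling G} {x y : V}
    (h : (wiredForest G U).Adj x y) (hy : y ∉ pond U x) :
    (U ⟨s(x, y), wiredForest_le U h⟩ : ℝ) = bottleneck U x ∨
      (U ⟨s(x, y), wiredForest_le U h⟩ : ℝ) = bottleneck U y := by
  have hx' : x ∉ pond U y := fun hx => hy (by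
    rw [pond_eq hconn hx]; exact mem_pond_self U y)
  have hG := wiredForest_le U h
  have h1 : bottleneck U x ≤ U ⟨s(x, y), hG⟩ := le_label_of_boundary (mem_pond_self U x) hy hG
  have h2 : bottleneck U y ≤ U ⟨s(x, y), hG⟩ := by
    have := le_label_of_boundary (mem_pond_self U y) hx' hG.symm
    simpa only [Sym2.eq_swap] using this
  by_contra! hcon
  exact ((wiredForest_adj_iff hfin hG).1 h).2
    ⟨infinite_of_bottleneck_lt hconn (lt_of_le_of_ne h1 hcon.1.symm),
      infinite_of_bottleneck_lt hconn (lt_of_le_of_ne h2 hcon.2.symm)⟩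

/-! ### The mass transport principle -/

theorem finite_ball (hconn : G.Connected) (hfin : ∀ v, (G.neighborSet v).Finite) (v : V) (n : ℕ) :
    {w | G.dist v w ≤ n}.Finite := by
  induction n with
  | zero =>
    refine (Set.finite_singleton v).subset fun w hw => ?_
    exact ((hconn.preconnected v w).dist_eq_zero_iff.1 (Nat.le_zero.1 hw)).symm
  | succ n ih =>
    refine (ih.union (ih.biUnion fun w _ => hfin w)).subset fun w hw => ?_
    obtain ⟨p, hp⟩ := (hconn.preconnected w v).exists_walk_length_eq_dist
    cases p with
    | nil => exact Or.inl (by simp)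
    | @cons _ z _ h q =>
      right
      refine Set.mem_biUnion (x := z) ?_ h.symm
      have h1 := SimpleGraph.dist_le q
      have h2 : G.dist w v ≤ n + 1 := by rw [SimpleGraph.dist_comm]; exact hw
      rw [SimpleGraph.Walk.length_cons] at hp
      show G.dist v z ≤ n
      rw [SimpleGraph.dist_comm]
      omega

theorem countable_of_connected (hconn : G.Connected) (hfin : ∀ v, (G.neighborSet v).Finite) :
    Countable V := by
  obtain ⟨v⟩ := hconn.nonempty
  have : (Set.univ : Set V) = ⋃ n, {w | G.dist v w ≤ n} := by
    ext w
    simp only [Set.mem_univ, Set.mem_iUnion, true_iff]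
    exact ⟨_, le_refl (G.dist v w)⟩
  rw [← Set.countable_univ_iff, this]
  exact Set.countable_iUnion fun n => (finite_ball hconn hfin v n).countable

theorem dist_le_of_iso (hconn : G.Connected) (φ : G ≃g G) (v w : V) :
    G.dist (φ v) (φ w) ≤ G.dist v w := by
  obtain ⟨p, hp⟩ := (hconn.preconnected v w).exists_walk_length_eq_dist
  rw [← hp, ← SimpleGraph.Walk.length_map φ.toHom p]
  exact SimpleGraph.dist_le _

theorem continuous_eval (v : V) :
    @Continuous _ _ (autTopology G) ⊥ (fun φ : G ≃g G => φ v) := by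
  let : TopologicalSpace V := ⊥
  let := autTopology G
  exact (continuous_apply v).comp continuous_induced_dom

theorem continuous_of_eval {X : Type*} [TopologicalSpace X] {F : X → (G ≃g G)}
    (h : ∀ v, @Continuous _ _ _ ⊥ (fun x => F x v)) : @Continuous _ _ _ (autTopology G) F := by
  let : TopologicalSpace V := ⊥
  exact continuous_induced_rng.2 (continuous_pi h)

theorem isOpen_setOf_apply_eq (v w : V) : @IsOpen _ (autTopology G) {φ : G ≃g G | φ v = w} := by
  let : TopologicalSpace V := ⊥
  have : DiscreteTopology V := ⟨rfl⟩
  let := autTopology G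
  exact (isOpen_discrete {w}).preimage (continuous_eval v)

/-- Vertex stabilizers are compact: an ultrafilter on the stabilizer of `v` converges pointwise,
because the images of each vertex stay in a finite ball around `v`, and so do the preimages. -/
theorem isCompact_stabilizer (hconn : G.Connected) (hfin : ∀ v, (G.neighborSet v).Finite) (v : V) :
    @IsCompact _ (autTopology G) {φ : G ≃g G | φ v = v} := by
  let : TopologicalSpace V := ⊥
  have : DiscreteTopology V := ⟨rfl⟩
  let := autTopology G
  rw [isCompact_iff_ultrafilter_le_nhds]
  intro f hf
  have hstab : ∀ᶠ φ in (f : Filter (G ≃g G)), φ v = v :=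
    Filter.le_principal_iff.1 hf
  have hlim : ∀ (F : (G ≃g G) → (G ≃g G)), (∀ φ, φ v = v → F φ v = v) →
      ∀ w, ∃ g, ∀ᶠ φ in (f : Filter (G ≃g G)), F φ w = g := by
    intro F hF w
    have hmem : {z | G.dist v z ≤ G.dist v w} ∈ f.map (fun φ => F φ w) := by
      rw [Ultrafilter.mem_map]
      filter_upwards [hstab] with φ hφ
      have := dist_le_of_iso hconn (F φ) v w
      rwa [hF φ hφ] at this
    obtain ⟨g, -, hg⟩ := Ultrafilter.eq_pure_of_finite_mem (finite_ball hconn hfin v _) hmem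
    refine ⟨g, ?_⟩
    have : {g} ∈ f.map (fun φ => F φ w) := by rw [hg]; exact Set.mem_singleton g
    exact this
  choose g hg using hlim id fun _ h => h
  choose k hk using hlim RelIso.symm fun φ h => by
    rw [RelIso.symm_apply_eq]; exact h.symm
  have hgk : ∀ w, k (g w) = w := fun w => by
    obtain ⟨φ, h1, h2⟩ := ((hg w).and (hk (g w))).exists
    rw [← h2, RelIso.symm_apply_eq]; exact h1.symm
  have hkg : ∀ w, g (k w) = w := fun w => by
    obtain ⟨φ, h1, h2⟩ := ((hg (k w)).and (hk w)).exists
    rw [← h1]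
    exact ((RelIso.symm_apply_eq φ).1 h2).symm
  let ψ : G ≃g G := ⟨⟨g, k, hgk, hkg⟩, fun {a b} => by
    obtain ⟨φ, h1, h2⟩ := ((hg a).and (hg b)).exists
    show G.Adj (g a) (g b) ↔ G.Adj a b
    rw [← h1, ← h2]
    exact φ.map_adj_iff⟩
  refine ⟨ψ, ?_, ?_⟩
  · obtain ⟨φ, h1, h2⟩ := ((hg v).and hstab).exists
    show g v = v
    rw [← h1]; exact h2
  · rw [nhds_induced, ← Filter.map_le_iff_le_comap]
    show Filter.Tendsto (fun φ : G ≃g G => (φ : V → V)) f (nhds ψ)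
    rw [tendsto_pi_nhds]
    intro w
    rw [nhds_discrete, Filter.tendsto_pure]
    exact hg w

/-- A `[0, ∞]`-valued function on pairs of vertices that is invariant under the diagonal action of
the automorphism group. -/
def IsDiagonallyInvariant (G : SimpleGraph V) (f : V → V → ℝ≥0∞) : Prop :=
  ∀ (φ : G ≃g G) (x y : V), f (φ x) (φ y) = f x y

open Classical in
/-- The mass transport principle. The weight `m v` is the Haar measure of the stabilizer of `v`;
both sides are the integral of `f a (φ b) = f (φ⁻¹ a) b` over the automorphisms `φ`, and right
invariance of the Haar measure is used for the sum over the orbit of `a`. -/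
theorem mass_transport (hconn : G.Connected) (hfin : ∀ v, (G.neighborSet v).Finite)
    (hunim : IsUnimodular G) : ∃ m : V → ℝ≥0∞, (∀ v, m v ≠ 0 ∧ m v ≠ ∞) ∧
      ∀ f : V → V → ℝ≥0∞, IsDiagonallyInvariant G f → ∀ a b,
        ∑' y, f a y * (if ∃ φ : G ≃g G, φ b = y then m b else 0) =
          ∑' y, f y b * (if ∃ φ : G ≃g G, φ a = y then m a else 0) := by
  have := countable_of_connected hconn hfin
  let : TopologicalSpace (G ≃g G) := autTopology G
  let : MeasurableSpace (G ≃g G) := borel (G ≃g G)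
  have : BorelSpace (G ≃g G) := ⟨rfl⟩
  obtain ⟨μ, hμ, hr⟩ := hunim
  let S : V → Set (G ≃g G) := fun v => {φ | φ v = v}
  have hmeas : ∀ v w, MeasurableSet {φ : G ≃g G | φ v = w} := fun v w =>
    (isOpen_setOf_apply_eq v w).measurableSet
  have hdecomp : ∀ (F : (G ≃g G) → V) (c : V → ℝ≥0∞), (∀ w, MeasurableSet {φ | F φ = w}) →
      ∫⁻ φ, c (F φ) ∂μ = ∑' y, c y * μ {φ | F φ = y} := by
    intro F c hF
    have hU : (⋃ y, {φ | F φ = y}) = Set.univ := Set.eq_univ_of_forall fun φ =>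
      Set.mem_iUnion.2 ⟨F φ, rfl⟩
    rw [← setLIntegral_univ, ← hU, lintegral_iUnion hF]
    · refine tsum_congr fun y => ?_
      rw [setLIntegral_congr_fun (hF y) (g := fun _ => c y) (fun φ hφ => by
        rw [show F φ = y from hφ]), setLIntegral_const]
    · intro y z hyz
      rw [Function.onFun, Set.disjoint_left]
      rintro φ rfl h
      exact hyz h
  refine ⟨fun v => μ (S v), fun v => ⟨?_, ?_⟩, fun f hf a b => ?_⟩
  · exact (isOpen_setOf_apply_eq v v).measure_ne_zero μ ⟨1, rfl⟩
  · exact (isCompact_stabilizer hconn hfin v).measure_ne_top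
  have h1 := hdecomp (fun φ => φ b) (f a) (hmeas b)
  have h2 := hdecomp (fun φ => φ.symm a) (fun y => f y b) (fun w => by
    have : {φ : G ≃g G | φ.symm a = w} = {φ : G ≃g G | φ w = a} := by
      ext φ
      exact (RelIso.symm_apply_eq φ).trans eq_comm
    rw [this]; exact hmeas w a)
  have h3 : ∀ φ : G ≃g G, f (φ.symm a) b = f a (φ b) := fun φ => by
    rw [← hf φ, RelIso.apply_symm_apply]
  simp only [h3] at h2
  rw [h1] at h2
  have hL : ∀ y, (if ∃ φ : G ≃g G, φ b = y then μ (S b) else 0) = μ {φ : G ≃g G | φ b = y} := by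
    intro y
    split_ifs with h
    · obtain ⟨ψ, rfl⟩ := h
      have hc : Measurable (fun φ : G ≃g G => ψ⁻¹ * φ) := by
        refine Continuous.measurable (continuous_of_eval fun v => ?_)
        let : TopologicalSpace V := ⊥
        have : DiscreteTopology V := ⟨rfl⟩
        exact (continuous_of_discreteTopology (f := (ψ⁻¹ : G ≃g G))).comp (continuous_eval v)
      have : μ.map (fun φ : G ≃g G => ψ⁻¹ * φ) (S b) = μ (S b) := by
        rw [hμ.toIsMulLeftInvariant.map_mul_left_eq_self ψ⁻¹]
      rw [Measure.map_apply hc (hmeas b b)] at this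
      rw [← this]
      congr 1
      ext φ
      show ψ.symm (φ b) = b ↔ φ b = ψ b
      rw [RelIso.symm_apply_eq]
    · have : {φ : G ≃g G | φ b = y} = ∅ := Set.eq_empty_of_forall_notMem fun φ hφ => h ⟨φ, hφ⟩
      rw [this, measure_empty]
  have hR : ∀ y, (if ∃ φ : G ≃g G, φ a = y then μ (S a) else 0) =
      μ {φ : G ≃g G | φ.symm a = y} := by
    intro y
    split_ifs with h
    · obtain ⟨ψ, rfl⟩ := h
      have hc : Measurable (fun φ : G ≃g G => φ * ψ) :=
        Continuous.measurable (continuous_of_eval fun v => continuous_eval (ψ v))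
      have : μ.map (fun φ : G ≃g G => φ * ψ) (S a) = μ (S a) := by
        rw [hr.map_mul_right_eq_self ψ]
      rw [Measure.map_apply hc (hmeas a a)] at this
      rw [← this]
      congr 1
      ext φ
      show φ (ψ a) = a ↔ φ.symm a = ψ a
      rw [RelIso.symm_apply_eq, eq_comm]
    · have : {φ : G ≃g G | φ.symm a = y} = ∅ :=
        Set.eq_empty_of_forall_notMem fun φ hφ => h ⟨φ.symm, hφ⟩
      rw [this, measure_empty]
  simp only [hL, hR]
  exact h2

/-- On a transitive unimodular graph, the expected mass sent equals the expected mass received. -/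
theorem mass_transport_of_isTransitive (hconn : G.Connected)
    (hfin : ∀ v, (G.neighborSet v).Finite) (hunim : IsUnimodular G) (htrans : IsTransitive G)
    {f : V → V → ℝ≥0∞} (hf : IsDiagonallyInvariant G f) (a : V) :
    ∑' y, f a y = ∑' y, f y a := by
  classical
  obtain ⟨m, hm, h⟩ := mass_transport hconn hfin hunim
  have := h f hf a a
  simp only [htrans a _, if_true, ENNReal.tsum_mul_right] at this
  exact (ENNReal.mul_left_inj (hm a).1 (hm a).2).1 this

/-- On a quasi-transitive unimodular graph, if every vertex sends a bounded expected mass, then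
every vertex receives a finite expected mass. -/
theorem mass_received_ne_top (hconn : G.Connected)
    (hfin : ∀ v, (G.neighborSet v).Finite) (hunim : IsUnimodular G) (hquasi : IsQuasiTransitive G)
    {f : V → V → ℝ≥0∞} (hf : IsDiagonallyInvariant G f) (hle : ∀ a, ∑' y, f a y ≤ 1) (b : V) :
    ∑' y, f y b ≠ ∞ := by
  classical
  obtain ⟨m, hm, h⟩ := mass_transport hconn hfin hunim
  have : Finite (Quotient (orbitSetoid G)) := hquasi
  let := Fintype.ofFinite (Quotient (orbitSetoid G))
  have hrep : ∀ y, f y b ≤ ∑ c : Quotient (orbitSetoid G),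
      f y b * ((if ∃ φ : G ≃g G, φ c.out = y then m c.out else 0) * (m c.out)⁻¹) := by
    intro y
    have hy : ∃ φ : G ≃g G, φ (Quotient.mk (orbitSetoid G) y).out = y :=
      Quotient.exact (Quotient.out_eq (Quotient.mk (orbitSetoid G) y))
    refine le_trans ?_ (Finset.single_le_sum (fun _ _ => zero_le)
      (Finset.mem_univ (Quotient.mk (orbitSetoid G) y)))
    rw [if_pos hy, ENNReal.mul_inv_cancel (hm _).1 (hm _).2, mul_one]
  refine ne_top_of_le_ne_top ?_ (ENNReal.tsum_le_tsum hrep)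
  rw [Summable.tsum_finsetSum fun _ _ => ENNReal.summable]
  refine ENNReal.sum_ne_top.2 fun c _ => ?_
  simp only [← mul_assoc]
  rw [ENNReal.tsum_mul_right, ← h f hf c.out b]
  refine ENNReal.mul_ne_top ?_ (ENNReal.inv_ne_top.2 (hm _).1)
  have hbd : ∀ y, f c.out y * (if ∃ φ : G ≃g G, φ b = y then m b else 0) ≤ f c.out y * m b := by
    intro y
    gcongr
    split_ifs
    · exact le_rfl
    · exact zero_le
  refine ne_top_of_le_ne_top ?_ (ENNReal.tsum_le_tsum hbd)
  rw [ENNReal.tsum_mul_right]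
  exact ENNReal.mul_ne_top (ne_top_of_le_ne_top ENNReal.one_ne_top (hle _)) (hm b).2

/-! ### Measurability of the percolation events -/

theorem measurableSet_reflTransGen [Countable V] {Ω : Type*} [MeasurableSpace Ω]
    {r : Ω → V → V → Prop} (h : ∀ a b, MeasurableSet {ω | r ω a b}) (a b : V) :
    MeasurableSet {ω | Relation.ReflTransGen (r ω) a b} := by
  let A : ℕ → V → Set Ω := fun n => Nat.rec (fun b => {_ω | a = b})
    (fun _ B b => ⋃ c, B c ∩ {ω | r ω c b}) n
  have hA : ∀ n b, MeasurableSet (A n b) := by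
    intro n
    induction n with
    | zero => exact fun b => MeasurableSet.const _
    | succ n ih => exact fun b => MeasurableSet.iUnion fun c => (ih c).inter (h c b)
  have : {ω | Relation.ReflTransGen (r ω) a b} = ⋃ n, A n b := by
    ext ω
    simp only [Set.mem_ofPred_eq, Set.mem_iUnion]
    constructor
    · intro hr
      induction hr with
      | refl => exact ⟨0, rfl⟩
      | tail _ h2 ih =>
        obtain ⟨n, hn⟩ := ih
        exact ⟨n + 1, Set.mem_iUnion.2 ⟨_, hn, h2⟩⟩
    · rintro ⟨n, hn⟩
      induction n generalizing b with
      | zero => rw [show a = b from hn]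
      | succ n ih =>
        obtain ⟨c, hc1, hc2⟩ := Set.mem_iUnion.1 hn
        exact (ih c hc1).tail hc2
  rw [this]
  exact MeasurableSet.iUnion fun n => hA n b

theorem measurable_label (e : G.edgeSet) : Measurable fun U : Labeling G => (U e : ℝ) :=
  measurable_subtype_coe.comp (measurable_pi_apply e)

theorem measurableSet_mem_cluster [Countable V] {τ : Labeling G → ℝ} (hτ : Measurable τ) (x y : V) :
    MeasurableSet {U : Labeling G | y ∈ cluster U (τ U) x} := by
  have : {U : Labeling G | y ∈ cluster U (τ U) x} =
      {U | Relation.ReflTransGen (fun a b => (percolation G U (τ U)).Adj a b) x y} := by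
    ext U
    exact SimpleGraph.reachable_iff_reflTransGen _ _
  rw [this]
  refine measurableSet_reflTransGen (fun a b => ?_) x y
  simp only [percolation_adj]
  by_cases h : G.Adj a b
  · simp only [h, exists_true_left]
    exact measurableSet_lt (measurable_label _) hτ
  · simp only [h, IsEmpty.exists_iff]
    exact MeasurableSet.const _

theorem measurableSet_cluster_infinite [Countable V] {τ : Labeling G → ℝ} (hτ : Measurable τ)
    (x : V) : MeasurableSet {U : Labeling G | (cluster U (τ U) x).Infinite} := by
  have : {U : Labeling G | (cluster U (τ U) x).Infinite} =
      ⋂ F : Finset V, ⋃ y : {y // y ∉ F}, {U | y.1 ∈ cluster U (τ U) x} := by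
    ext U
    simp only [Set.mem_ofPred_eq, Set.mem_iInter, Set.mem_iUnion, Subtype.exists]
    constructor
    · intro h F
      obtain ⟨y, hy, hF⟩ := h.exists_notMem_finset F
      exact ⟨y, hF, hy⟩
    · intro h hfin
      obtain ⟨y, hy, hy'⟩ := h hfin.toFinset
      exact hy (hfin.mem_toFinset.2 hy')
  rw [this]
  exact MeasurableSet.iInter fun F => MeasurableSet.iUnion fun y =>
    measurableSet_mem_cluster hτ x y.1

theorem measurable_bottleneck [Infinite V] [Countable V] (hconn : G.Connected) (x : V) :
    Measurable fun U : Labeling G => bottleneck U x := by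
  refine measurable_of_Iio fun t => ?_
  have : (fun U : Labeling G => bottleneck U x) ⁻¹' Set.Iio t =
      ⋃ q : {q : ℚ // (q : ℝ) < t}, {U | (cluster U (q : ℝ) x).Infinite} := by
    ext U
    simp only [Set.mem_preimage, Set.mem_Iio, Set.mem_iUnion, Set.mem_ofPred_eq]
    constructor
    · intro h
      obtain ⟨q, hq1, hq2⟩ := exists_rat_btwn h
      exact ⟨⟨q, hq2⟩, infinite_of_bottleneck_lt hconn hq1⟩
    · rintro ⟨⟨q, hq⟩, h⟩
      exact (bottleneck_le h).trans_lt hq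
  rw [this]
  exact MeasurableSet.iUnion fun q => measurableSet_cluster_infinite measurable_const x

theorem measurableSet_mem_pond [Infinite V] [Countable V] (hconn : G.Connected) (x y : V) :
    MeasurableSet {U : Labeling G | y ∈ pond U x} :=
  measurableSet_mem_cluster (measurable_bottleneck hconn x) x y

theorem measurableSet_pond_infinite [Infinite V] [Countable V] (hconn : G.Connected) (x : V) :
    MeasurableSet {U : Labeling G | (pond U x).Infinite} :=
  measurableSet_cluster_infinite (measurable_bottleneck hconn x) x

theorem measurableSet_pondStep [Infinite V] [Countable V] (hconn : G.Connected) (v w : V) :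
    MeasurableSet {U : Labeling G | PondStep U v w} := by
  have : {U : Labeling G | PondStep U v w} = ⋃ u, {U | u ∈ pond U v} ∩ ({U | w ∈ pond U v}ᶜ ∩
      {U | ∃ h : G.Adj u w, (U ⟨s(u, w), h⟩ : ℝ) = bottleneck U v}) := by
    ext U
    simp [PondStep]
  rw [this]
  refine MeasurableSet.iUnion fun u => (measurableSet_mem_pond hconn v u).inter
    ((measurableSet_mem_pond hconn v w).compl.inter ?_)
  by_cases h : G.Adj u w
  · simp only [h, exists_true_left]
    exact measurableSet_eq_fun (measurable_label _) (measurable_bottleneck hconn v)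
  · simp only [h, IsEmpty.exists_iff]
    exact MeasurableSet.const _

theorem measurableSet_wiredForest_adj [Countable V] (hfin : ∀ v, (G.neighborSet v).Finite)
    (x y : V) : MeasurableSet {U : Labeling G | (wiredForest G U).Adj x y} := by
  by_cases h : G.Adj x y
  · simp only [wiredForest_adj_iff hfin h]
    exact (measurableSet_mem_cluster (measurable_label _) x y).compl.inter
      ((measurableSet_cluster_infinite (measurable_label _) x).inter
        (measurableSet_cluster_infinite (measurable_label _) y)).compl
  · have : {U : Labeling G | (wiredForest G U).Adj x y} = ∅ :=
      Set.eq_empty_of_forall_notMem fun U hU => h (wiredForest_le U hU)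
    rw [this]
    exact MeasurableSet.empty

/-! ### Automorphism invariance -/

/-- The labeling obtained from `U` by pulling back along an automorphism. -/
def pull (φ : G ≃g G) (U : Labeling G) : Labeling G := fun e => U (φ.mapEdgeSet e)

theorem measurePreserving_pull (φ : G ≃g G) :
    MeasurePreserving (pull φ) (labelMeasure G) (labelMeasure G) :=
  ⟨measurable_pi_lambda _ fun _ => measurable_pi_apply _,
    Measure.map_infinitePi_infinitePi_of_inj (φ.mapEdgeSet).injective⟩

/-- An automorphism as an isomorphism of percolation configurations. -/
def percolationIso (φ : G ≃g G) (U : Labeling G) (t : ℝ) :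
    percolation G (pull φ U) t ≃g percolation G U t where
  toEquiv := φ.toEquiv
  map_rel_iff' := by
    intro a b
    show (percolation G U t).Adj (φ a) (φ b) ↔ _
    rw [percolation_adj, percolation_adj]
    constructor
    · rintro ⟨h, hl⟩
      exact ⟨φ.map_adj_iff.1 h, hl⟩
    · rintro ⟨h, hl⟩
      exact ⟨φ.map_adj_iff.2 h, hl⟩

theorem mem_cluster_pull {φ : G ≃g G} {U : Labeling G} {t : ℝ} {x y : V} :
    y ∈ cluster (pull φ U) t x ↔ φ y ∈ cluster U t (φ x) :=
  (SimpleGraph.Iso.reachable_iff (φ := percolationIso φ U t)).symm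

theorem cluster_pull (φ : G ≃g G) (U : Labeling G) (t : ℝ) (x : V) :
    cluster (pull φ U) t x = φ ⁻¹' cluster U t (φ x) := Set.ext fun _ => mem_cluster_pull

theorem cluster_pull_infinite {φ : G ≃g G} {U : Labeling G} {t : ℝ} {x : V} :
    (cluster (pull φ U) t x).Infinite ↔ (cluster U t (φ x)).Infinite := by
  rw [cluster_pull]
  exact not_congr ⟨fun h => h.of_preimage φ.surjective, fun h => h.preimage φ.injective.injOn⟩

theorem bottleneck_pull (φ : G ≃g G) (U : Labeling G) (x : V) :
    bottleneck (pull φ U) x = bottleneck U (φ x) := by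
  simp only [bottleneck, cluster_pull_infinite]

theorem mem_pond_pull {φ : G ≃g G} {U : Labeling G} {x y : V} :
    y ∈ pond (pull φ U) x ↔ φ y ∈ pond U (φ x) := by
  rw [pond, bottleneck_pull, mem_cluster_pull, pond]

theorem pond_pull_infinite {φ : G ≃g G} {U : Labeling G} {x : V} :
    (pond (pull φ U) x).Infinite ↔ (pond U (φ x)).Infinite := by
  rw [pond, bottleneck_pull, cluster_pull_infinite, pond]

theorem label_pull_eq_iff {φ : G ≃g G} {U : Labeling G} {x y : V} {t : ℝ} :
    (∃ h : G.Adj x y, (pull φ U ⟨s(x, y), h⟩ : ℝ) = t) ↔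
      ∃ h : G.Adj (φ x) (φ y), (U ⟨s(φ x, φ y), h⟩ : ℝ) = t :=
  ⟨fun ⟨h, hl⟩ => ⟨φ.map_adj_iff.2 h, hl⟩, fun ⟨h, hl⟩ => ⟨φ.map_adj_iff.1 h, hl⟩⟩

theorem pondStep_pull {φ : G ≃g G} {U : Labeling G} {v w : V} :
    PondStep (pull φ U) v w ↔ PondStep U (φ v) (φ w) := by
  simp only [PondStep, mem_pond_pull, label_pull_eq_iff, bottleneck_pull]
  exact φ.surjective.exists (p := fun u => u ∈ pond U (φ v) ∧ φ w ∉ pond U (φ v) ∧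
    ∃ h : G.Adj u (φ w), (U ⟨s(u, φ w), h⟩ : ℝ) = bottleneck U (φ v)) |>.symm

theorem wiredForest_pull_adj (hfin : ∀ v, (G.neighborSet v).Finite) {φ : G ≃g G} {U : Labeling G}
    {x y : V} : (wiredForest G (pull φ U)).Adj x y ↔ (wiredForest G U).Adj (φ x) (φ y) := by
  constructor
  · intro h
    have hG := wiredForest_le _ h
    rw [wiredForest_adj_iff hfin hG, mem_cluster_pull, cluster_pull_infinite,
      cluster_pull_infinite] at h
    exact (wiredForest_adj_iff hfin (φ.map_adj_iff.2 hG)).2 h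
  · intro h
    have hG := φ.map_adj_iff.1 (wiredForest_le _ h)
    rw [wiredForest_adj_iff hfin (φ.map_adj_iff.2 hG)] at h
    rw [wiredForest_adj_iff hfin hG, mem_cluster_pull, cluster_pull_infinite,
      cluster_pull_infinite]
    exact h

theorem isDiagonallyInvariant_lintegral {F : V → V → Labeling G → ℝ≥0∞}
    (hF : ∀ x y, Measurable (F x y))
    (hinv : ∀ (φ : G ≃g G) x y U, F x y (pull φ U) = F (φ x) (φ y) U) :
    IsDiagonallyInvariant G fun x y => ∫⁻ U, F x y U ∂(labelMeasure G) := by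
  intro φ x y
  simp only [← hinv]
  exact (measurePreserving_pull φ).lintegral_comp (hF x y)

/-! ### Resampling the label of an edge -/

instance : IsProbabilityMeasure (labelMeasure G) := by
  unfold labelMeasure; infer_instance

theorem measurable_update_prod [DecidableEq G.edgeSet] (e : G.edgeSet) :
    Measurable fun p : Labeling G × unitInterval => Function.update p.1 e p.2 := by
  refine measurable_pi_lambda _ fun e' => ?_
  by_cases h : e' = e
  · subst h; simpa using measurable_snd
  · simp only [Function.update_of_ne h]
    exact (measurable_pi_apply e').comp measurable_fst

/-- Replacing the label of one edge by an independent uniform label preserves the law. -/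
theorem measurePreserving_update [DecidableEq G.edgeSet] (e : G.edgeSet) :
    MeasurePreserving (fun p : Labeling G × unitInterval => Function.update p.1 e p.2)
      ((labelMeasure G).prod volume) (labelMeasure G) := by
  refine ⟨measurable_update_prod e, Measure.eq_infinitePi _ fun s t ht => ?_⟩
  rw [Measure.map_apply (measurable_update_prod e)
    (MeasurableSet.pi s.countable_toSet fun i _ => ht i)]
  have hpi : ∀ s' : Finset G.edgeSet, labelMeasure G (Set.pi s' t) =
      ∏ i ∈ s', (volume : Measure unitInterval) (t i) := fun s' =>
    Measure.infinitePi_pi _ fun i _ => ht i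
  by_cases hes : e ∈ s
  · have : (fun p : Labeling G × unitInterval => Function.update p.1 e p.2) ⁻¹' Set.pi s t =
        Set.pi (s.erase e) t ×ˢ t e := by
      ext ⟨U, r⟩
      simp only [Set.mem_preimage, Set.mem_pi, Set.mem_prod, Finset.mem_coe, Finset.mem_erase]
      constructor
      · intro h
        refine ⟨fun i hi => ?_, by simpa using h e hes⟩
        have := h i hi.2
        rwa [Function.update_of_ne hi.1] at this
      · rintro ⟨h1, h2⟩ i hi
        by_cases hie : i = e
        · subst hie; simpa using h2
        · rw [Function.update_of_ne hie]; exact h1 i ⟨hie, hi⟩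
    rw [this, Measure.prod_prod, hpi, mul_comm]
    exact Finset.mul_prod_erase s (fun i => (volume : Measure unitInterval) (t i)) hes
  · have : (fun p : Labeling G × unitInterval => Function.update p.1 e p.2) ⁻¹' Set.pi s t =
        Set.pi s t ×ˢ Set.univ := by
      ext ⟨U, r⟩
      simp only [Set.mem_preimage, Set.mem_pi, Set.mem_prod, Finset.mem_coe, Set.mem_univ, and_true]
      refine forall₂_congr fun i hi => ?_
      rw [Function.update_of_ne (by rintro rfl; exact hes hi)]
    rw [this, Measure.prod_prod, hpi, measure_univ, mul_one]

/-- The label of `e` almost surely avoids a value that depends only on the other labels. -/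
theorem ae_label_ne [DecidableEq G.edgeSet] (e : G.edgeSet) {g : Labeling G → ℝ}
    (hg : Measurable g) : ∀ᵐ U ∂(labelMeasure G), (U e : ℝ) ≠ g (Function.update U e 1) := by
  have hupd : Measurable fun U : Labeling G => Function.update U e 1 :=
    (measurable_update_prod e).comp (measurable_id.prodMk measurable_const)
  have hS : MeasurableSet {U : Labeling G | (U e : ℝ) = g (Function.update U e 1)} :=
    measurableSet_eq_fun (measurable_label e) (hg.comp hupd)
  have hmp := measurePreserving_update (G := G) e
  rw [ae_iff]
  simp only [ne_eq, not_not]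
  rw [← hmp.measure_preimage hS.nullMeasurableSet,
    Measure.measure_prod_null (hmp.measurable hS)]
  refine Filter.Eventually.of_forall fun U => ?_
  refine Set.Subsingleton.measure_zero (fun r hr r' hr' => ?_) _
  simp only [Set.mem_preimage, Set.mem_ofPred_eq, Function.update_self, Function.update_idem]
    at hr hr'
  exact Subtype.ext (hr.trans hr'.symm)

instance [Countable V] : Countable G.edgeSet :=
  have : Countable (Sym2 V) := inferInstanceAs (Countable (Quot _))
  inferInstance

theorem ae_isGeneric [Infinite V] [Countable V] (hconn : G.Connected) :
    ∀ᵐ U ∂(labelMeasure G), IsGeneric U := by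
  classical
  have h1 : ∀ᵐ U ∂(labelMeasure G), ∀ (e : G.edgeSet) (w : V),
      (U e : ℝ) ≠ bottleneck (Function.update U e 1) w :=
    ae_all_iff.2 fun e => ae_all_iff.2 fun w => ae_label_ne e (measurable_bottleneck hconn w)
  have h2 : ∀ᵐ U ∂(labelMeasure G), ∀ e e' : G.edgeSet, e' ≠ e → U e ≠ U e' := by
    refine ae_all_iff.2 fun e => ae_all_iff.2 fun e' => ?_
    filter_upwards [ae_label_ne e (measurable_label e')] with U hU hne h
    rw [Function.update_of_ne hne] at hU
    exact hU (congrArg Subtype.val h)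
  filter_upwards [h1, h2] with U hU1 hU2
  refine ⟨fun e e' h => ?_, fun e w => ?_⟩
  · by_contra hne
    exact hU2 e e' (Ne.symm hne) h
  · convert hU1 e w

/-- Insertion tolerance: almost surely, the labels of finitely many edges can be lowered below a
given positive level in such a way that an almost sure property holds for the new labeling. -/
theorem ae_exists_lowered {p : Labeling G → Prop} (hp : ∀ᵐ U ∂(labelMeasure G), p U) {q : ℝ}
    (hq : 0 < q) (l : List G.edgeSet) : ∀ᵐ U ∂(labelMeasure G), ∃ U' : Labeling G,
      (∀ e, e ∉ l → U' e = U e) ∧ (∀ e ∈ l, (U' e : ℝ) < q) ∧ p U' := by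
  classical
  induction l generalizing p with
  | nil =>
    filter_upwards [hp] with U hU
    exact ⟨U, fun _ _ => rfl, by simp, hU⟩
  | cons e l ih =>
    have h1 : ∀ᵐ U ∂(labelMeasure G), ∃ r : unitInterval, (r : ℝ) < q ∧ p (Function.update U e r) := by
      have h2 := Measure.ae_ae_of_ae_prod
        ((measurePreserving_update (G := G) e).quasiMeasurePreserving.ae hp)
      filter_upwards [h2] with U hU
      have hpos : (volume : Measure unitInterval) {r : unitInterval | (r : ℝ) < q} ≠ 0 := by
        rw [unitInterval.volume_apply]
        have hsub : Set.Ioo 0 (min q 1) ⊆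
            (Subtype.val '' {r : unitInterval | (r : ℝ) < q} : Set ℝ) := fun r hr =>
          ⟨⟨r, hr.1.le, hr.2.le.trans (min_le_right _ _)⟩, hr.2.trans_le (min_le_left _ _), rfl⟩
        refine (lt_of_lt_of_le ?_ (measure_mono hsub)).ne'
        simp [hq]
      by_contra! hcon
      refine hpos (measure_mono_null (fun r hr => ?_) (ae_iff.1 hU))
      exact hcon r hr
    filter_upwards [ih h1] with U hU
    obtain ⟨U', h3, h4, r, hr, h5⟩ := hU
    refine ⟨Function.update U' e r, fun e' he' => ?_, fun e' he' => ?_, h5⟩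
    · rw [List.mem_cons, not_or] at he'
      rw [Function.update_of_ne he'.1, h3 e' he'.2]
    · by_cases h : e' = e
      · subst h; simpa using hr
      · rw [Function.update_of_ne h]
        exact h4 e' ((List.mem_cons.1 he').resolve_left h)

/-! ### Counting forest edges -/

open Classical in
/-- The indicator of a proposition, as an extended nonnegative real. -/
def ind (p : Prop) : ℝ≥0∞ := if p then 1 else 0

theorem ind_of_true {p : Prop} (h : p) : ind p = 1 := if_pos h

theorem ind_of_false {p : Prop} (h : ¬p) : ind p = 0 := if_neg h

theorem ind_le_one (p : Prop) : ind p ≤ 1 := by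
  unfold ind; split_ifs <;> simp

theorem ind_or {p q : Prop} (h : ¬(p ∧ q)) : ind (p ∨ q) = ind p + ind q := by
  by_cases hp : p <;> by_cases hq : q <;> simp_all [ind]

theorem measurable_ind {Ω : Type*} [MeasurableSpace Ω] {p : Ω → Prop}
    (h : MeasurableSet {ω | p ω}) : Measurable fun ω => ind (p ω) := by
  classical
  exact Measurable.ite h measurable_const measurable_const

theorem tsum_ind_mem (s : Set V) : ∑' z, ind (z ∈ s) = (s.encard : ℝ≥0∞) := by
  classical
  rw [← ENNReal.tsum_set_one, tsum_subtype s (fun _ => (1 : ℝ≥0∞))]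
  refine tsum_congr fun z => ?_
  by_cases h : z ∈ s <;> simp [ind, h]

theorem tsum_ind_mem_of_finite {s : Set V} (hs : s.Finite) :
    ∑' z, ind (z ∈ s) = (s.ncard : ℝ≥0∞) := by
  rw [tsum_ind_mem, ← hs.cast_ncard_eq]
  simp

/-- The wired forest restricted to a finite cluster is a spanning tree of that cluster. -/
theorem isTree_induce_cluster (hfin : ∀ v, (G.neighborSet v).Finite) {U : Labeling G}
    (hU : Function.Injective U) {t : ℝ} {x : V} (hK : (cluster U t x).Finite) :
    ((wiredForest G U).induce (cluster U t x)).IsTree := by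
  refine ⟨?_, (wiredForest_isAcyclic hfin hU).induce _⟩
  have key : ∀ y (hy : y ∈ cluster U t x), ((wiredForest G U).induce (cluster U t x)).Reachable
      ⟨x, mem_cluster_self U t x⟩ ⟨y, hy⟩ := by
    intro y hy
    have hsub : reachSet (wiredForest G U ⊓ percolation G U t) x ⊆ {z | ∃ hz : z ∈ cluster U t x,
        ((wiredForest G U).induce (cluster U t x)).Reachable ⟨x, mem_cluster_self U t x⟩
          ⟨z, hz⟩} := by
      refine reachSet_subset ⟨mem_cluster_self U t x, .refl _⟩ ?_
      rintro a b ⟨ha, hra⟩ ⟨hab1, hab2⟩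
      have hb : b ∈ cluster U t x := SimpleGraph.Reachable.trans ha hab2.reachable
      refine ⟨hb, hra.trans (SimpleGraph.Adj.reachable ?_)⟩
      exact hab1
    exact (hsub (reachable_wiredForest_of_finite hfin hK hy)).2
  have : Nonempty (cluster U t x) := ⟨⟨x, mem_cluster_self U t x⟩⟩
  exact ⟨fun a b => (key a.1 a.2).symm.trans (key b.1 b.2)⟩

/-- A tree on `k` vertices has degree sum `2 (k - 1)`. -/
theorem tsum_ind_adj_of_isTree {T : SimpleGraph V} {K : Set V} (hK : K.Finite)
    (hT : (T.induce K).IsTree) :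
    ∑' x, ∑' z, ind (x ∈ K ∧ z ∈ K ∧ T.Adj x z) = 2 * ((K.ncard - 1 : ℕ) : ℝ≥0∞) := by
  classical
  let : Fintype K := hK.fintype
  have h1 : ∑' x, ∑' z, ind (x ∈ K ∧ z ∈ K ∧ T.Adj x z) =
      ∑ x : K, ((T.induce K).degree x : ℝ≥0∞) := by
    rw [← tsum_subtype_eq_of_support_subset (s := K), tsum_fintype]
    · refine Finset.sum_congr rfl fun x _ => ?_
      rw [← tsum_subtype_eq_of_support_subset (s := K), tsum_fintype]
      · rw [← SimpleGraph.card_neighborFinset_eq_degree, SimpleGraph.neighborFinset_eq_filter,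
          Finset.card_filter, Nat.cast_sum]
        refine Finset.sum_congr rfl fun z _ => ?_
        simp [ind]
      · intro z hz
        by_contra hzK
        exact hz (ind_of_false fun h => hzK h.2.1)
    · intro x hx
      by_contra hxK
      refine hx ?_
      simp only [ENNReal.tsum_eq_zero]
      exact fun z => ind_of_false fun h => hxK h.1
  rw [h1, ← Nat.cast_sum, SimpleGraph.sum_degrees_eq_twice_card_edges]
  have h2 := hT.card_edgeFinset
  have h3 : Fintype.card K = K.ncard := by
    rw [← Nat.card_eq_fintype_card]; rfl
  have h4 : (T.induce K).edgeFinset.card = K.ncard - 1 := by omega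
  rw [h4]
  push_cast
  rfl

/-- The edge `xz` is the outlet of the pond of `y`, and `x` is its endpoint in that pond. -/
def IsOutlet (U : Labeling G) (y x z : V) : Prop :=
  x ∈ pond U y ∧ z ∉ pond U y ∧ ∃ h : G.Adj x z, (U ⟨s(x, z), h⟩ : ℝ) = bottleneck U y

theorem tsum_ind_isOutlet [Infinite V] (hconn : G.Connected)
    (hfin : ∀ v, (G.neighborSet v).Finite) {U : Labeling G} (hU : Function.Injective U) {y : V}
    (hy : (pond U y).Finite) : ∑' x, ∑' z, ind (IsOutlet U y x z) = 1 := by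
  obtain ⟨u, w, hu, hw, h, he⟩ := exists_outlet hconn hfin hy
  have huniq : ∀ x z, IsOutlet U y x z → u = x ∧ w = z := by
    rintro x z ⟨hx, hz, h', he'⟩
    exact eq_of_outlet hU hu hx hz (he.trans he'.symm)
  rw [tsum_eq_single u, tsum_eq_single w]
  · exact ind_of_true ⟨hu, hw, h, he⟩
  · exact fun z hz => ind_of_false fun h => hz (huniq u z h).2.symm
  · intro x hx
    simp only [ENNReal.tsum_eq_zero]
    exact fun z => ind_of_false fun h => hx (huniq x z h).1.symm

/-! ### Finite pieces of the ponds -/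

open Classical in
/-- The bottleneck of `x` if its pond is finite, and slightly less otherwise. -/
def pieceLevel (n : ℕ) (U : Labeling G) (x : V) : ℝ :=
  if (pond U x).Infinite then bottleneck U x - 1 / ((n : ℝ) + 1) else bottleneck U x

/-- A finite piece of the pond of `x`: all of it if the pond is finite. Pieces partition the
vertices, and increase to the ponds as `n` tends to infinity. -/
def piece (n : ℕ) (U : Labeling G) (x : V) : Set V := cluster U (pieceLevel n U x) x

theorem pieceLevel_le (n : ℕ) (U : Labeling G) (x : V) : pieceLevel n U x ≤ bottleneck U x := by
  unfold pieceLevel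
  split_ifs
  · have : 0 < 1 / ((n : ℝ) + 1) := by positivity
    linarith
  · exact le_rfl

theorem piece_eq_pond {U : Labeling G} {x : V} (h : (pond U x).Finite) (n : ℕ) :
    piece n U x = pond U x := by
  rw [piece, pieceLevel, if_neg (Set.not_infinite.2 h), pond]

theorem piece_finite (n : ℕ) (U : Labeling G) (x : V) : (piece n U x).Finite := by
  by_cases h : (pond U x).Infinite
  · rw [piece, pieceLevel, if_pos h]
    refine finite_of_lt_bottleneck ?_
    have : 0 < 1 / ((n : ℝ) + 1) := by positivity
    linarith
  · rw [piece_eq_pond (Set.not_infinite.1 h)]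
    exact Set.not_infinite.1 h

theorem mem_piece_self (n : ℕ) (U : Labeling G) (x : V) : x ∈ piece n U x := mem_cluster_self _ _ _

theorem piece_subset_pond (n : ℕ) (U : Labeling G) (x : V) : piece n U x ⊆ pond U x :=
  cluster_mono U (pieceLevel_le n U x) x

theorem piece_eq [Infinite V] (hconn : G.Connected) {n : ℕ} {U : Labeling G} {x y : V}
    (h : y ∈ piece n U x) : piece n U y = piece n U x := by
  have hp := piece_subset_pond n U x h
  have hl : pieceLevel n U y = pieceLevel n U x := by
    rw [pieceLevel, pieceLevel, pond_eq hconn hp, bottleneck_eq_of_mem_pond hconn hp]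
  rw [piece, hl]
  exact (cluster_eq h).symm

theorem mem_piece_comm [Infinite V] (hconn : G.Connected) {n : ℕ} {U : Labeling G} {x y : V} :
    y ∈ piece n U x ↔ x ∈ piece n U y :=
  ⟨fun h => by rw [piece_eq hconn h]; exact mem_piece_self _ _ _,
    fun h => by rw [piece_eq hconn h]; exact mem_piece_self _ _ _⟩

theorem eventually_mem_piece {U : Labeling G} {x y : V} (h : y ∈ pond U x) :
    ∀ᶠ n in Filter.atTop, y ∈ piece n U x := by
  by_cases hinf : (pond U x).Infinite
  · obtain ⟨s, hs, hy⟩ := exists_lt_mem_cluster h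
    have h1 : ∀ᶠ n : ℕ in Filter.atTop, 1 / ((n : ℝ) + 1) < bottleneck U x - s :=
      (tendsto_one_div_add_atTop_nhds_zero_nat (𝕜 := ℝ)).eventually_lt_const (by linarith)
    filter_upwards [h1] with n hn
    rw [piece, pieceLevel, if_pos hinf]
    exact cluster_mono U (by linarith) x hy
  · refine Filter.Eventually.of_forall fun n => ?_
    rwa [piece_eq_pond (Set.not_infinite.1 hinf)]

theorem tendsto_ncard_piece {U : Labeling G} {x : V} (h : (pond U x).Infinite) :
    Filter.Tendsto (fun n => (piece n U x).ncard) Filter.atTop Filter.atTop := by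
  refine Filter.tendsto_atTop.2 fun N => ?_
  obtain ⟨S, hS, hcard⟩ := h.exists_subset_card_eq N
  have : ∀ᶠ n in Filter.atTop, ∀ y ∈ S, y ∈ piece n U x :=
    (Filter.eventually_all_finset S).2 fun y hy => eventually_mem_piece (hS hy)
  filter_upwards [this] with n hn
  rw [← hcard, ← Set.ncard_coe_finset]
  exact Set.ncard_le_ncard hn (piece_finite n U x)

/-- The forest edge `xz` belongs to the piece of `y`: it joins two vertices of that piece, or it is
the outlet of the pond of `y`, which is finite. -/
def Owns (n : ℕ) (U : Labeling G) (y x z : V) : Prop :=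
  (x ∈ piece n U y ∧ z ∈ piece n U y ∧ (wiredForest G U).Adj x z) ∨
    ((pond U y).Finite ∧ (IsOutlet U y x z ∨ IsOutlet U y z x))

/-- The number of incidences of edges belonging to the piece of `y`. -/
theorem tsum_ind_owns [Infinite V] (hconn : G.Connected)
    (hfin : ∀ v, (G.neighborSet v).Finite) {U : Labeling G} (hU : Function.Injective U)
    (n : ℕ) (y : V) : ∑' x, ∑' z, ind (Owns n U y x z) =
      2 * (((piece n U y).ncard - 1 : ℕ) : ℝ≥0∞) + 2 * ind (pond U y).Finite := by
  have hsplit : ∀ x z, ind (Owns n U y x z) =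
      ind (x ∈ piece n U y ∧ z ∈ piece n U y ∧ (wiredForest G U).Adj x z) +
        (ind (pond U y).Finite * ind (IsOutlet U y x z) +
          ind (pond U y).Finite * ind (IsOutlet U y z x)) := by
    intro x z
    have hsub := piece_subset_pond n U y
    have hdisj : ¬((x ∈ piece n U y ∧ z ∈ piece n U y ∧ (wiredForest G U).Adj x z) ∧
        ((pond U y).Finite ∧ (IsOutlet U y x z ∨ IsOutlet U y z x))) := by
      rintro ⟨⟨hx, hz, -⟩, -, h | h⟩
      · exact h.2.1 (hsub hz)
      · exact h.2.1 (hsub hx)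
    have hdisj' : ¬(IsOutlet U y x z ∧ IsOutlet U y z x) := fun h => h.1.2.1 h.2.1
    rw [Owns, ind_or hdisj, ← mul_add, ← ind_or hdisj']
    congr 1
    by_cases h1 : (pond U y).Finite
    · rw [ind_of_true h1, one_mul, propext (and_iff_right h1)]
    · rw [ind_of_false h1, zero_mul, ind_of_false fun h => h1 h.1]
  simp only [hsplit, ENNReal.tsum_add, ENNReal.tsum_mul_left]
  have h1 : ∑' x, ∑' z, ind (x ∈ piece n U y ∧ z ∈ piece n U y ∧ (wiredForest G U).Adj x z) =
      2 * (((piece n U y).ncard - 1 : ℕ) : ℝ≥0∞) :=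
    tsum_ind_adj_of_isTree (piece_finite n U y)
      (isTree_induce_cluster hfin hU (piece_finite n U y))
  have h2 : ind (pond U y).Finite * ∑' x, ∑' z, ind (IsOutlet U y x z) =
      ind (pond U y).Finite := by
    by_cases h : (pond U y).Finite
    · rw [tsum_ind_isOutlet hconn hfin hU h, mul_one]
    · rw [ind_of_false h, zero_mul]
  have h3 : ∑' x, ∑' z, ind (IsOutlet U y z x) = ∑' x, ∑' z, ind (IsOutlet U y x z) :=
    ENNReal.tsum_comm
  rw [h1, h3, h2, two_mul (ind _)]

/-- The pieces owning a given forest edge form a single class. -/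
theorem mem_piece_of_owns [Infinite V] (hconn : G.Connected)
    (hfin : ∀ v, (G.neighborSet v).Finite) {U : Labeling G} (hU : IsGeneric U) {n : ℕ}
    {y y' x z : V} (h : Owns n U y x z) (h' : Owns n U y' x z) : y' ∈ piece n U y := by
  have hsame : ∀ v, v ∈ pond U y → v ∈ pond U y' → pond U y = pond U y' := fun v h1 h2 =>
    (pond_eq hconn h1).symm.trans (pond_eq hconn h2)
  have hlt : ∀ y a b, (pond U y).Finite → IsOutlet U y a b →
      bottleneck U b < bottleneck U a := by
    rintro y a b hf ⟨ha, hb, hG, he⟩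
    rw [bottleneck_eq_of_mem_pond hconn ha]
    exact bottleneck_lt_of_outlet hconn hfin hU hf ha hb hG he
  have hfinpond : (pond U y).Finite → pond U y = pond U y' → y' ∈ piece n U y := fun hf he => by
    rw [piece_eq_pond hf, he]; exact mem_pond_self U y'
  have hsub := piece_subset_pond n U y
  have hsub' := piece_subset_pond n U y'
  rcases h with ⟨hx, hz, -⟩ | ⟨hf, ho⟩
  · rcases h' with ⟨hx', -, -⟩ | ⟨-, ho' | ho'⟩
    · rw [← piece_eq hconn hx, mem_piece_comm hconn]
      rwa [mem_piece_comm hconn, mem_piece_comm hconn]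
    · exact absurd (hsame x (hsub hx) ho'.1 ▸ hsub hz) ho'.2.1
    · exact absurd (hsame z (hsub hz) ho'.1 ▸ hsub hx) ho'.2.1
  · rcases h' with ⟨hx', hz', -⟩ | ⟨hf', ho'⟩
    · rcases ho with ho | ho
      · exact absurd (hsame x ho.1 (hsub' hx') ▸ hsub' hz') ho.2.1
      · exact absurd (hsame z ho.1 (hsub' hz') ▸ hsub' hx') ho.2.1
    · rcases ho with ho | ho <;> rcases ho' with ho' | ho'
      · exact hfinpond hf (hsame x ho.1 ho'.1)
      · exact absurd (hlt y x z hf ho) (hlt y' z x hf' ho').le.not_gt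
      · exact absurd (hlt y z x hf ho) (hlt y' x z hf' ho').le.not_gt
      · exact hfinpond hf (hsame z ho.1 ho'.1)

theorem owns_of_mem_piece [Infinite V] (hconn : G.Connected) {U : Labeling G} {n : ℕ}
    {y y' x z : V} (h : Owns n U y x z) (h' : y' ∈ piece n U y) : Owns n U y' x z := by
  have hp := piece_subset_pond n U y h'
  rw [Owns, IsOutlet, IsOutlet, piece_eq hconn h', pond_eq hconn hp,
    bottleneck_eq_of_mem_pond hconn hp]
  exact h

theorem Owns.adj (hfin : ∀ v, (G.neighborSet v).Finite) {U : Labeling G} {n : ℕ} {y x z : V}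
    (h : Owns n U y x z) : (wiredForest G U).Adj x z := by
  rcases h with h | ⟨hf, ⟨hx, hz, hG, he⟩ | ⟨hx, hz, hG, he⟩⟩
  · exact h.2.2
  · exact wiredForest_adj_of_outlet hfin hf hx hz hG he
  · exact (wiredForest_adj_of_outlet hfin hf hx hz hG he).symm

/-- In the limit, every forest edge belongs to a piece. -/
theorem eventually_exists_owns [Infinite V] (hconn : G.Connected)
    (hfin : ∀ v, (G.neighborSet v).Finite) {U : Labeling G} (hU : IsGeneric U) {x z : V}
    (h : (wiredForest G U).Adj x z) : ∀ᶠ n in Filter.atTop, ∃ y, Owns n U y x z := by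
  have hG := wiredForest_le U h
  by_cases hz : z ∈ pond U x
  · filter_upwards [eventually_mem_piece hz] with n hn
    exact ⟨x, Or.inl ⟨mem_piece_self n U x, hn, h⟩⟩
  · refine Filter.Eventually.of_forall fun n => ?_
    rcases outlet_or_outlet hconn hfin h hz with he | he
    · exact ⟨x, Or.inr ⟨pond_finite_of_label_eq hconn hU hG he,
        Or.inl ⟨mem_pond_self U x, hz, hG, he⟩⟩⟩
    · have he' : (U ⟨s(z, x), hG.symm⟩ : ℝ) = bottleneck U z := by
        simpa only [Sym2.eq_swap] using he
      refine ⟨z, Or.inr ⟨pond_finite_of_label_eq hconn hU hG.symm he',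
        Or.inr ⟨mem_pond_self U z, fun hx => hz ?_, hG.symm, he'⟩⟩⟩
      rw [pond_eq hconn hx]; exact mem_pond_self U z

/-! ### The expected degree -/

/-- The mass that `x` sends to `y`: the number of edges at `x` that belong to the piece of `y`,
shared equally among the vertices of that piece. -/
def edgeMass (n : ℕ) (U : Labeling G) (x y : V) : ℝ≥0∞ :=
  (∑' z, ind (Owns n U y x z)) * (∑' v, ind (v ∈ piece n U y))⁻¹

theorem measurable_pieceLevel [Infinite V] [Countable V] (hconn : G.Connected) (n : ℕ) (x : V) :
    Measurable fun U : Labeling G => pieceLevel n U x := by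
  unfold pieceLevel
  exact Measurable.ite (measurableSet_pond_infinite hconn x)
    ((measurable_bottleneck hconn x).sub_const _) (measurable_bottleneck hconn x)

theorem measurableSet_mem_piece [Infinite V] [Countable V] (hconn : G.Connected) (n : ℕ) (x y : V) :
    MeasurableSet {U : Labeling G | y ∈ piece n U x} :=
  measurableSet_mem_cluster (measurable_pieceLevel hconn n x) x y

theorem measurableSet_isOutlet [Infinite V] [Countable V] (hconn : G.Connected) (y x z : V) :
    MeasurableSet {U : Labeling G | IsOutlet U y x z} := by
  refine (measurableSet_mem_pond hconn y x).inter
    ((measurableSet_mem_pond hconn y z).compl.inter ?_)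
  by_cases h : G.Adj x z
  · simp only [h, exists_true_left]
    exact measurableSet_eq_fun (measurable_label _) (measurable_bottleneck hconn y)
  · simp only [h, IsEmpty.exists_iff]
    exact MeasurableSet.const _

theorem measurableSet_owns [Infinite V] [Countable V] (hconn : G.Connected)
    (hfin : ∀ v, (G.neighborSet v).Finite) (n : ℕ) (y x z : V) :
    MeasurableSet {U : Labeling G | Owns n U y x z} := by
  refine ((measurableSet_mem_piece hconn n y x).inter ((measurableSet_mem_piece hconn n y z).inter
    (measurableSet_wiredForest_adj hfin x z))).union (MeasurableSet.inter ?_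
    ((measurableSet_isOutlet hconn y x z).union (measurableSet_isOutlet hconn y z x)))
  have : {U : Labeling G | (pond U y).Finite} = {U | (pond U y).Infinite}ᶜ := by
    ext U
    exact Set.not_infinite.symm
  change MeasurableSet {U : Labeling G | (pond U y).Finite}
  rw [this]
  exact (measurableSet_pond_infinite hconn y).compl

theorem measurable_edgeMass [Infinite V] [Countable V] (hconn : G.Connected)
    (hfin : ∀ v, (G.neighborSet v).Finite) (n : ℕ) (x y : V) :
    Measurable fun U : Labeling G => edgeMass n U x y :=
  (Measurable.tsum fun z => measurable_ind (measurableSet_owns hconn hfin n y x z)).mul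
    (Measurable.tsum fun v => measurable_ind (measurableSet_mem_piece hconn n y v)).inv

theorem mem_piece_pull {n : ℕ} {φ : G ≃g G} {U : Labeling G} {x y : V} :
    y ∈ piece n (pull φ U) x ↔ φ y ∈ piece n U (φ x) := by
  have : pieceLevel n (pull φ U) x = pieceLevel n U (φ x) := by
    classical
    simp only [pieceLevel, pond_pull_infinite, bottleneck_pull]
  rw [piece, this, mem_cluster_pull, piece]

theorem isOutlet_pull {φ : G ≃g G} {U : Labeling G} {x y z : V} :
    IsOutlet (pull φ U) y x z ↔ IsOutlet U (φ y) (φ x) (φ z) := by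
  simp only [IsOutlet, mem_pond_pull, label_pull_eq_iff, bottleneck_pull]

theorem owns_pull (hfin : ∀ v, (G.neighborSet v).Finite) {n : ℕ} {φ : G ≃g G} {U : Labeling G}
    {x y z : V} : Owns n (pull φ U) y x z ↔ Owns n U (φ y) (φ x) (φ z) := by
  have : (pond (pull φ U) y).Finite ↔ (pond U (φ y)).Finite := by
    rw [← Set.not_infinite, pond_pull_infinite, Set.not_infinite]
  simp only [Owns, mem_piece_pull, isOutlet_pull, wiredForest_pull_adj hfin, this]

theorem edgeMass_pull (hfin : ∀ v, (G.neighborSet v).Finite) (n : ℕ) (φ : G ≃g G) (x y : V)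
    (U : Labeling G) : edgeMass n (pull φ U) x y = edgeMass n U (φ x) (φ y) := by
  simp only [edgeMass, owns_pull hfin, mem_piece_pull]
  congr 1
  · exact φ.toEquiv.tsum_eq (fun z => ind (Owns n U (φ y) (φ x) z))
  · exact congrArg _ (φ.toEquiv.tsum_eq (fun z => ind (z ∈ piece n U (φ y))))

/-- The mass sent by `x` is the number of edges at `x` that belong to some piece. -/
theorem tsum_edgeMass_sent [Infinite V] (hconn : G.Connected)
    (hfin : ∀ v, (G.neighborSet v).Finite) {U : Labeling G} (hU : IsGeneric U) (n : ℕ) (x : V) :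
    ∑' y, edgeMass n U x y = ∑' z, ind (∃ y, Owns n U y x z) := by
  simp only [edgeMass, ← ENNReal.tsum_mul_right]
  rw [ENNReal.tsum_comm]
  refine tsum_congr fun z => ?_
  by_cases h : ∃ y, Owns n U y x z
  · obtain ⟨y, hy⟩ := h
    rw [ind_of_true ⟨y, hy⟩]
    have hterm : ∀ y', ind (Owns n U y' x z) * (∑' v, ind (v ∈ piece n U y'))⁻¹ =
        ind (y' ∈ piece n U y) * (∑' v, ind (v ∈ piece n U y))⁻¹ := by
      intro y'
      by_cases hy' : y' ∈ piece n U y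
      · rw [ind_of_true hy', ind_of_true (owns_of_mem_piece hconn hy hy'), piece_eq hconn hy']
      · rw [ind_of_false hy', ind_of_false fun h => hy' (mem_piece_of_owns hconn hfin hU hy h),
          zero_mul, zero_mul]
    simp only [hterm]
    rw [ENNReal.tsum_mul_right]
    have hfinp := piece_finite n U y
    rw [tsum_ind_mem_of_finite hfinp]
    refine ENNReal.mul_inv_cancel ?_ (ENNReal.natCast_ne_top _)
    rw [Nat.cast_ne_zero]
    exact (Set.ncard_pos hfinp).2 ⟨y, mem_piece_self n U y⟩ |>.ne'
  · rw [ind_of_false h]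
    simp only [ENNReal.tsum_eq_zero]
    intro y
    rw [ind_of_false fun hy => h ⟨y, hy⟩, zero_mul]

/-- The mass received by `y` is `2`, up to an error that vanishes as the pieces grow. -/
theorem tsum_edgeMass_received [Infinite V] (hconn : G.Connected)
    (hfin : ∀ v, (G.neighborSet v).Finite) {U : Labeling G} (hU : IsGeneric U) (n : ℕ) (y : V) :
    ∑' x, edgeMass n U x y =
      2 - 2 * (ind (pond U y).Infinite * ((piece n U y).ncard : ℝ≥0∞)⁻¹) := by
  simp only [edgeMass]
  have hfinp := piece_finite n U y
  have hpos : 0 < (piece n U y).ncard := (Set.ncard_pos hfinp).2 ⟨y, mem_piece_self n U y⟩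
  obtain ⟨k, hk⟩ : ∃ k, (piece n U y).ncard = k + 1 := ⟨_, (Nat.succ_pred_eq_of_pos hpos).symm⟩
  rw [ENNReal.tsum_mul_right, tsum_ind_owns hconn hfin hU.injective,
    tsum_ind_mem_of_finite hfinp, hk, Nat.add_sub_cancel]
  have hne : ((k + 1 : ℕ) : ℝ≥0∞) ≠ 0 := Nat.cast_ne_zero.2 k.succ_ne_zero
  have hnt : ((k + 1 : ℕ) : ℝ≥0∞) ≠ ∞ := ENNReal.natCast_ne_top _
  by_cases h : (pond U y).Infinite
  · rw [ind_of_true h, ind_of_false (fun hf => h hf), mul_zero, add_zero, one_mul]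
    refine (ENNReal.sub_eq_of_eq_add ?_ ?_).symm
    · exact ENNReal.mul_ne_top (by simp) (ENNReal.inv_ne_top.2 hne)
    · rw [← add_mul, ← mul_add_one, ← Nat.cast_succ, mul_assoc, ENNReal.mul_inv_cancel hne hnt,
        mul_one]
  · rw [ind_of_false h, ind_of_true (Set.not_infinite.1 h), zero_mul, mul_zero, tsub_zero,
      ← mul_add, ← Nat.cast_add_one, mul_assoc, ENNReal.mul_inv_cancel hne hnt, mul_one]

theorem lintegral_tsum_ind_owns [Infinite V] [Countable V] (hconn : G.Connected)
    (hfin : ∀ v, (G.neighborSet v).Finite) (hunim : IsUnimodular G) (htrans : IsTransitive G)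
    (n : ℕ) (x : V) :
    ∫⁻ U : Labeling G, ∑' z, ind (∃ y, Owns n U y x z) ∂(labelMeasure G) =
      ∫⁻ U : Labeling G, ∑' y, edgeMass n U y x ∂(labelMeasure G) := by
  have hmeas := fun x y => measurable_edgeMass hconn hfin n x y
  have h := mass_transport_of_isTransitive hconn hfin hunim htrans
    (isDiagonallyInvariant_lintegral (F := fun x y U => edgeMass n U x y) hmeas
      fun φ x y U => edgeMass_pull hfin n φ x y U) x
  rw [← lintegral_tsum fun y => (hmeas x y).aemeasurable,
    ← lintegral_tsum fun y => (hmeas y x).aemeasurable] at h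
  rw [← h]
  refine lintegral_congr_ae ?_
  filter_upwards [ae_isGeneric hconn] with U hU
  exact (tsum_edgeMass_sent hconn hfin hU n x).symm

theorem tsum_ind_le_of_imp_adj {p : V → Prop} {x : V} (h : ∀ z, p z → G.Adj x z) :
    ∑' z, ind (p z) ≤ ((G.neighborSet x).encard : ℝ≥0∞) := by
  rw [← tsum_ind_mem]
  refine ENNReal.tsum_le_tsum fun z => ?_
  by_cases hz : p z
  · rw [ind_of_true hz, ind_of_true (show z ∈ G.neighborSet x from h z hz)]
  · rw [ind_of_false hz]; exact zero_le

/-- In a transitive unimodular graph the expected degree in the wired forest is `2`. -/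
theorem wiredExpectedDegree_eq_two [Infinite V] (hconn : G.Connected)
    (hfin : ∀ v, (G.neighborSet v).Finite) (hunim : IsUnimodular G) (htrans : IsTransitive G)
    (x : V) : wiredExpectedDegree G x = 2 := by
  have := countable_of_connected hconn hfin
  have hD : ((G.neighborSet x).encard : ℝ≥0∞) ≠ ∞ := by
    rw [← (hfin x).cast_ncard_eq]; simp
  -- the number of edges at `x` that belong to a piece converges to the degree of `x`
  have hlim1 : Filter.Tendsto
      (fun n : ℕ => ∫⁻ U : Labeling G, ∑' z, ind (∃ y, Owns n U y x z) ∂(labelMeasure G))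
      Filter.atTop (nhds (wiredExpectedDegree G x)) := by
    refine tendsto_lintegral_of_dominated_convergence
      (fun _ => ((G.neighborSet x).encard : ℝ≥0∞)) (fun n => ?_) (fun n => ?_) ?_ ?_
    · refine Measurable.tsum fun z => measurable_ind ?_
      have : {U : Labeling G | ∃ y, Owns n U y x z} = ⋃ y, {U | Owns n U y x z} := by
        ext U; simp
      rw [this]
      exact MeasurableSet.iUnion fun y => measurableSet_owns hconn hfin n y x z
    · refine Filter.Eventually.of_forall fun U => tsum_ind_le_of_imp_adj fun z hz => ?_
      obtain ⟨y, hy⟩ := hz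
      exact wiredForest_le U (hy.adj hfin)
    · rw [lintegral_const, measure_univ, mul_one]; exact hD
    · filter_upwards [ae_isGeneric hconn] with U hU
      have hset : ∀ᶠ n in Filter.atTop, ∀ z ∈ (wiredForest G U).neighborSet x,
          ∃ y, Owns n U y x z := by
        have hf : ((wiredForest G U).neighborSet x).Finite :=
          (hfin x).subset fun z hz => wiredForest_le U hz
        exact (Filter.eventually_all_finite hf).2 fun z hz =>
          eventually_exists_owns hconn hfin hU hz
      refine tendsto_const_nhds.congr' ?_
      filter_upwards [hset] with n hn
      rw [← tsum_ind_mem]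
      refine tsum_congr fun z => ?_
      congr 1
      exact propext ⟨hn z, fun ⟨y, hy⟩ => hy.adj hfin⟩
  have hlim2 : Filter.Tendsto
      (fun n : ℕ => ∫⁻ U : Labeling G, ∑' y, edgeMass n U y x ∂(labelMeasure G))
      Filter.atTop (nhds 2) := by
    have h2 : ∫⁻ _ : Labeling G, (2 : ℝ≥0∞) ∂(labelMeasure G) = 2 := by
      rw [lintegral_const, measure_univ, mul_one]
    rw [← h2]
    refine tendsto_lintegral_of_dominated_convergence (fun _ => 2) (fun n => ?_) (fun n => ?_) ?_ ?_
    · exact Measurable.tsum fun y => measurable_edgeMass hconn hfin n y x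
    · filter_upwards [ae_isGeneric hconn] with U hU
      rw [tsum_edgeMass_received hconn hfin hU]
      exact tsub_le_self
    · rw [h2]; simp
    · filter_upwards [ae_isGeneric hconn] with U hU
      simp only [tsum_edgeMass_received hconn hfin hU]
      by_cases h : (pond U x).Infinite
      · simp only [ind_of_true h, one_mul]
        have h3 := ENNReal.tendsto_inv_nat_nhds_zero.comp (tendsto_ncard_piece h)
        have h4 := ENNReal.Tendsto.sub (tendsto_const_nhds (x := (2 : ℝ≥0∞)))
          (ENNReal.Tendsto.const_mul (a := 2) h3 (Or.inr (by simp))) (Or.inl (by simp))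
        simpa using h4
      · simp only [ind_of_false h, zero_mul, mul_zero, tsub_zero]
        exact tendsto_const_nhds
  simp only [lintegral_tsum_ind_owns hconn hfin hunim htrans] at hlim1
  exact tendsto_nhds_unique hlim1 hlim2

/-! ### Descending through the ponds -/

/-- A step from `v` through the outlet of its pond, allowed when the bottleneck of `v` is at least
`q`. -/
def StepAbove (q : ℝ) (U : Labeling G) (v w : V) : Prop := PondStep U v w ∧ q ≤ bottleneck U v

/-- Following the outlets of successive ponds from `y`, the first vertex of bottleneck less than
`q` that is entered is `w`. -/
def Crosses (q : ℝ) (U : Labeling G) (y w : V) : Prop :=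
  Relation.ReflTransGen (StepAbove q U) y w ∧ bottleneck U w < q

theorem Crosses.unique {U : Labeling G} (hU : Function.Injective U) {q : ℝ} {y w w' : V}
    (h : Crosses q U y w) (h' : Crosses q U y w') : w = w' := by
  have hru : Relator.RightUnique (StepAbove q U) := fun a b c hb hc =>
    pondStep_rightUnique hU hb.1 hc.1
  have stuck : ∀ {a b}, bottleneck U a < q → Relation.ReflTransGen (StepAbove q U) a b → a = b := by
    intro a b ha hab
    rcases Relation.ReflTransGen.cases_head hab with h | ⟨c, hc, -⟩
    · exact h
    · exact absurd hc.2 (not_le.2 ha)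
  rcases Relation.ReflTransGen.total_of_right_unique hru h.1 h'.1 with h1 | h1
  · exact stuck h.2 h1
  · exact (stuck h'.2 h1).symm

theorem tsum_ind_crosses_le_one {U : Labeling G} (hU : Function.Injective U) (q : ℝ) (y : V) :
    ∑' w, ind (Crosses q U y w) ≤ 1 := by
  by_cases h : ∃ w, Crosses q U y w
  · obtain ⟨w, hw⟩ := h
    rw [tsum_eq_single w fun w' hw' => ind_of_false fun h => hw' (h.unique hU hw)]
    exact ind_le_one _
  · have : ∀ w, ind (Crosses q U y w) = 0 := fun w => ind_of_false fun hw => h ⟨w, hw⟩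
    simp [this]

theorem measurableSet_crosses [Infinite V] [Countable V] (hconn : G.Connected) (q : ℝ) (y w : V) :
    MeasurableSet {U : Labeling G | Crosses q U y w} := by
  refine MeasurableSet.inter (measurableSet_reflTransGen (fun a b => ?_) y w)
    (measurableSet_lt (measurable_bottleneck hconn w) measurable_const)
  exact (measurableSet_pondStep hconn a b).inter
    (measurableSet_le measurable_const (measurable_bottleneck hconn a))

theorem crosses_pull {φ : G ≃g G} {U : Labeling G} {q : ℝ} {y w : V} :
    Crosses q (pull φ U) y w ↔ Crosses q U (φ y) (φ w) := by
  have hstep : ∀ a b, StepAbove q (pull φ U) a b ↔ StepAbove q U (φ a) (φ b) := fun a b => by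
    simp only [StepAbove, pondStep_pull, bottleneck_pull]
  rw [Crosses, Crosses, bottleneck_pull]
  refine and_congr_left fun _ => ⟨fun h => ?_, fun h => ?_⟩
  · exact h.lift φ fun a b hab => (hstep a b).1 hab
  · have := h.lift (p := StepAbove q (pull φ U)) φ.symm fun a b hab => by
      rw [Function.onFun, hstep, RelIso.apply_symm_apply, RelIso.apply_symm_apply]; exact hab
    rwa [Function.onFun, RelIso.symm_apply_apply, RelIso.symm_apply_apply] at this

/-- Labelings in general position for which only finitely many vertices cross a given rational level
at a given vertex. -/
structure IsTame (U : Labeling G) : Prop extends IsGeneric U where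
  finite_crosses : ∀ (q : ℚ) (w : V), {y | Crosses (q : ℝ) U y w}.Finite

/-- By mass transport the expected number of vertices that cross a level at a given vertex is
finite, since every vertex crosses it at most once. -/
theorem ae_isTame [Infinite V] (hconn : G.Connected) (hfin : ∀ v, (G.neighborSet v).Finite)
    (hquasi : IsQuasiTransitive G) (hunim : IsUnimodular G) :
    ∀ᵐ U ∂(labelMeasure G), IsTame U := by
  have := countable_of_connected hconn hfin
  have hmeas := fun (q : ℝ) y w => measurable_ind (measurableSet_crosses hconn q y w)
  have h1 : ∀ (q : ℚ) (w : V), ∀ᵐ U ∂(labelMeasure G), {y | Crosses (q : ℝ) U y w}.Finite := by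
    intro q w
    have hinv := isDiagonallyInvariant_lintegral
      (F := fun y w (U : Labeling G) => ind (Crosses (q : ℝ) U y w)) (hmeas q)
      fun φ y w U => by simp only [crosses_pull]
    have hne := mass_received_ne_top hconn hfin hunim hquasi hinv (fun a => by
      rw [← lintegral_tsum fun y => (hmeas q a y).aemeasurable]
      refine (lintegral_mono_ae (g := fun _ => 1) ?_).trans (by simp)
      filter_upwards [ae_isGeneric hconn] with U hU
      exact tsum_ind_crosses_le_one hU.injective q a) w
    have hmu : ∀ y, ∫⁻ U, ind (Crosses (q : ℝ) U y w) ∂(labelMeasure G) =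
        labelMeasure G {U | Crosses (q : ℝ) U y w} := by
      intro y
      classical
      rw [← lintegral_indicator_one (measurableSet_crosses hconn q y w)]
      refine lintegral_congr fun U => ?_
      by_cases h : Crosses (q : ℝ) U y w <;> simp [ind, h]
    simp only [hmu] at hne
    exact ae_finite_setOfPred_mem hne
  filter_upwards [ae_isGeneric hconn, ae_all_iff.2 fun q => ae_all_iff.2 fun w => h1 q w] with U h2 h3
  exact ⟨h2, h3⟩

/-! ### Excluding infinite ponds -/

/-- An infinite pond cannot have its bottleneck above a level `q` at which there are infinite
clusters. Otherwise, open at level `q` a path from the pond to such a cluster. In the new labeling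
the old pond is cut into finite ponds, which flow into the finitely many vertices of the old pond
that are linked to the path at some level `q' > q`, so that infinitely many vertices cross the
level `q'` at the same vertex. -/
theorem false_of_lowered [Infinite V] (hconn : G.Connected) (hfin : ∀ v, (G.neighborSet v).Finite)
    {U U' : Labeling G} (hU' : IsTame U') {x y : V} {q : ℝ} {q' : ℚ} (hqq : q < q')
    (hqx : (q' : ℝ) < bottleneck U x) (hC : (pond U x).Infinite) (hy : (cluster U q y).Infinite)
    (p : G.Walk x y) (hsame : ∀ e : G.edgeSet, (e : Sym2 V) ∉ p.edges → U' e = U e)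
    (hlow : ∀ e : G.edgeSet, (e : Sym2 V) ∈ p.edges → (U' e : ℝ) < q) : False := by
  have hmono : ∀ t, q ≤ t → ∀ v, cluster U t v ⊆ cluster U' t v := by
    intro t ht v
    refine reachSet_mono (fun a b hab => ?_) v
    obtain ⟨hG, hl⟩ := percolation_adj.1 hab
    refine percolation_adj.2 ⟨hG, ?_⟩
    by_cases he : s(a, b) ∈ p.edges
    · exact (hlow ⟨_, hG⟩ he).trans_le ht
    · rwa [hsame ⟨_, hG⟩ he]
  have hpath : ∀ m ∈ p.support, m ∈ cluster U' q x := by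
    classical
    intro m hm
    refine SimpleGraph.Walk.reachable ((p.takeUntil m hm).transfer _ fun e he => ?_)
    have he' := p.edges_takeUntil_subset_edges hm he
    induction e with | _ a b =>
    exact percolation_adj.2 ⟨p.edges_subset_edgeSet he', hlow ⟨_, p.edges_subset_edgeSet he'⟩ he'⟩
  have hinfx : (cluster U' q x).Infinite := by
    rw [cluster_eq (hpath y p.end_mem_support)]
    exact hy.mono (hmono q le_rfl y)
  have hZm : ∀ m ∈ p.support, bottleneck U' m ≤ q := fun m hm =>
    bottleneck_le (by rwa [← cluster_eq (hpath m hm)])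
  -- away from the path the labels have not changed
  have hlabel : ∀ a b (h : G.Adj a b), a ∉ p.support → U' ⟨s(a, b), h⟩ = U ⟨s(a, b), h⟩ :=
    fun a b h ha => hsame _ fun he => ha (p.fst_mem_support_of_mem_edges he)
  have hsub : ∀ t v, (∀ m ∈ p.support, m ∉ cluster U t v) → cluster U' t v ⊆ cluster U t v := by
    intro t v hv
    refine reachSet_subset (mem_cluster_self U t v) fun a b ha hab => ?_
    obtain ⟨hG, hl⟩ := percolation_adj.1 hab
    refine mem_cluster_of_adj ha hG ?_
    rwa [← hlabel a b hG fun h => hv a h ha]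
  have hsub' : ∀ t v, (∀ m ∈ p.support, m ∉ cluster U' t v) → cluster U' t v ⊆ cluster U t v := by
    intro t v hv
    have : cluster U' t v ⊆ {a | a ∈ cluster U' t v ∧ a ∈ cluster U t v} := by
      refine reachSet_subset ⟨mem_cluster_self _ _ _, mem_cluster_self _ _ _⟩ ?_
      rintro a b ⟨ha', ha⟩ hab
      obtain ⟨hG, hl⟩ := percolation_adj.1 hab
      refine ⟨mem_cluster_of_adj ha' hG hl, mem_cluster_of_adj ha hG ?_⟩
      rwa [← hlabel a b hG fun h => hv a h ha']
    exact fun a ha => (this ha).2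
  have havoid : ∀ v, (q' : ℝ) ≤ bottleneck U' v → ∀ m ∈ p.support, m ∉ pond U' v := by
    intro v hv m hm hmv
    have h1 := bottleneck_eq_of_mem_pond hconn hmv
    have h2 := hZm m hm
    linarith
  have hCZ : ∀ v ∈ pond U x, bottleneck U v = bottleneck U x := fun v hv =>
    bottleneck_eq_of_mem_pond hconn hv
  have hCsub : ∀ v ∈ pond U x, ∀ t ≤ bottleneck U x, cluster U t v ⊆ pond U x := by
    intro v hv t ht
    rw [← pond_eq hconn hv, pond, hCZ v hv]
    exact cluster_mono U ht v
  have hZlt : ∀ v ∈ pond U x, bottleneck U' v < bottleneck U x := by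
    intro v hv
    obtain ⟨s, hs, hvs⟩ := exists_lt_mem_cluster hv
    have h1 : v ∈ cluster U' (max s q) x :=
      hmono _ (le_max_right _ _) x (cluster_mono U (le_max_left _ _) x hvs)
    refine (bottleneck_le ?_).trans_lt (max_lt hs (hqq.trans hqx))
    rw [← cluster_eq h1]
    exact hinfx.mono (cluster_mono U' (le_max_right _ _) x)
  have hpfin : ∀ v ∈ pond U x, (q' : ℝ) ≤ bottleneck U' v → (pond U' v).Finite := by
    intro v hv hq
    refine (finite_of_lt_bottleneck ?_).subset (hsub' _ v (havoid v hq))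
    rw [hCZ v hv]
    exact hZlt v hv
  have hstep : ∀ v ∈ pond U x, (q' : ℝ) ≤ bottleneck U' v → ∀ w, PondStep U' v w →
      ∀ r, bottleneck U' v < r → w ∈ cluster U r v := by
    rintro v hv hq w ⟨u, hu, -, hG, he⟩ r hr
    have huU : u ∈ cluster U r v :=
      cluster_mono U hr.le v (hsub' _ v (havoid v hq) hu)
    refine mem_cluster_of_adj huU hG ?_
    rw [← hlabel u w hG fun h => havoid v hq u h hu, he]
    exact hr
  -- every vertex of the old pond crosses the level `q'` inside the old pond
  have hcross : ∀ v ∈ pond U x, ∃ w ∈ pond U x, Crosses (q' : ℝ) U' v w := by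
    intro v hv
    by_cases hq : bottleneck U' v < q'
    · exact ⟨v, hv, .refl, hq⟩
    obtain ⟨r, hr1, hr2⟩ := exists_between (hZlt v hv)
    let D : Set V := {w | Relation.ReflTransGen (StepAbove (q' : ℝ) U') v w}
    have hD : D ⊆ {w | w ∈ cluster U r v ∧ bottleneck U' w ≤ bottleneck U' v} := by
      intro w hw
      induction hw with
      | refl => exact ⟨mem_cluster_self _ _ _, le_rfl⟩
      | @tail b c _ hbc ih =>
        have hb : b ∈ pond U x := hCsub v hv r hr2.le ih.1
        refine ⟨SimpleGraph.Reachable.trans ih.1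
          (hstep b hb hbc.2 c hbc.1 r (ih.2.trans_lt hr1)), ?_⟩
        exact (hbc.1.bottleneck_lt hconn hfin hU'.toIsGeneric (hpfin b hb hbc.2)).le.trans ih.2
    have hDC : D ⊆ pond U x := fun w hw => hCsub v hv r hr2.le (hD hw).1
    have hDfin : D.Finite := by
      refine (finite_of_lt_bottleneck ?_).subset fun w hw => (hD hw).1
      rw [hCZ v hv]; exact hr2
    obtain ⟨w, hw, hmin⟩ := Set.exists_min_image D (bottleneck U') hDfin ⟨v, .refl⟩
    refine ⟨w, hDC hw, hw, ?_⟩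
    by_contra! hwq
    obtain ⟨a, b, ha, hb, hab, he⟩ := exists_outlet hconn hfin (hpfin w (hDC hw) hwq)
    have hs : PondStep U' w b := ⟨a, ha, hb, hab, he⟩
    have h1 := hs.bottleneck_lt hconn hfin hU'.toIsGeneric (hpfin w (hDC hw) hwq)
    exact absurd (hmin b (Relation.ReflTransGen.tail hw ⟨hs, hwq⟩)) (not_le.2 h1)
  have hW : {w | w ∈ pond U x ∧ bottleneck U' w < q'}.Finite := by
    have hM : {m | m ∈ p.support ∧ m ∈ pond U x}.Finite :=
      (List.finite_toSet p.support).subset fun m hm => hm.1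
    refine (hM.biUnion (t := fun m => cluster U q' m) fun m hm => ?_).subset ?_
    · refine finite_of_lt_bottleneck ?_
      rw [hCZ m hm.2]; exact hqx
    · rintro w ⟨hw, hwq⟩
      have h1 : ¬ ∀ m ∈ p.support, m ∉ cluster U q' w := by
        intro hno
        refine infinite_of_bottleneck_lt hconn hwq ((finite_of_lt_bottleneck ?_).subset
          (hsub q' w hno))
        rw [hCZ w hw]; exact hqx
      push Not at h1
      obtain ⟨m, hm, hmw⟩ := h1
      exact Set.mem_biUnion (x := m) ⟨hm, hCsub w hw q' hqx.le hmw⟩ (mem_cluster_symm hmw)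
  refine hC ((hW.biUnion fun w _ => hU'.finite_crosses q' w).subset fun v hv => ?_)
  obtain ⟨w, hw, hc⟩ := hcross v hv
  exact Set.mem_biUnion (x := w) ⟨hw, hc.2⟩ hc

theorem supp_connectedComponentMk (U : Labeling G) (t : ℝ) (v : V) :
    ((percolation G U t).connectedComponentMk v).supp = cluster U t v := by
  ext w
  rw [SimpleGraph.ConnectedComponent.mem_supp_iff, SimpleGraph.ConnectedComponent.eq]
  exact ⟨fun h => h.symm, fun h => h.symm⟩

/-- The edges of a walk, as a list of edges of the graph. -/
def walkEdges {x y : V} (p : G.Walk x y) : List G.edgeSet :=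
  p.edges.attach.map fun e => ⟨e.1, p.edges_subset_edgeSet e.2⟩

theorem mem_walkEdges {x y : V} {p : G.Walk x y} {e : G.edgeSet} :
    e ∈ walkEdges p ↔ (e : Sym2 V) ∈ p.edges := by
  simp only [walkEdges, List.mem_map, List.mem_attach, true_and, Subtype.exists]
  constructor
  · rintro ⟨a, ha, rfl⟩
    exact ha
  · intro h
    exact ⟨e, h, rfl⟩

/-- If `G[t]` has no infinite cluster at one vertex, it has none at all: a path from `v` to `o`
can be opened. -/
theorem ae_cluster_finite [Countable V] (hconn : G.Connected) {t : ℝ} {o : V}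
    (h : theta G t o = 0) : ∀ᵐ U ∂(labelMeasure G), ∀ v, (cluster U t v).Finite := by
  rcases le_or_gt t 0 with ht | ht
  · refine Filter.Eventually.of_forall fun U v => Set.not_infinite.1 fun hinf => ?_
    exact absurd (pos_of_infinite hinf) (not_lt.2 ht)
  have h0 : ∀ᵐ U ∂(labelMeasure G), (cluster U t o).Finite := by
    rw [ae_iff]
    simp only [theta, supp_connectedComponentMk] at h
    exact h
  rw [ae_all_iff]
  intro v
  obtain ⟨p⟩ := hconn.preconnected o v
  filter_upwards [ae_exists_lowered h0 ht (walkEdges p)] with U hU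
  obtain ⟨U', hsame, hlow, hf⟩ := hU
  have hv : v ∈ cluster U' t o := by
    refine SimpleGraph.Walk.reachable (p.transfer _ fun e he => ?_)
    induction e with | _ a b =>
    exact percolation_adj.2 ⟨p.edges_subset_edgeSet he,
      hlow ⟨_, p.edges_subset_edgeSet he⟩ (mem_walkEdges.2 he)⟩
  rw [cluster_eq hv] at hf
  refine hf.subset (reachSet_mono (fun a b hab => ?_) v)
  obtain ⟨hG, hl⟩ := percolation_adj.1 hab
  refine percolation_adj.2 ⟨hG, ?_⟩
  by_cases he : (⟨s(a, b), hG⟩ : G.edgeSet) ∈ walkEdges p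
  · exact hlow _ he
  · rwa [hsame _ he]

theorem criticalProbability_nonneg : 0 ≤ criticalProbability G :=
  Real.sInf_nonneg fun _ h => h.1.1

/-- Above the critical probability there are infinite clusters. -/
theorem ae_exists_infinite [Infinite V] [Countable V] (hconn : G.Connected) {q : ℝ}
    (hq : criticalProbability G < q) :
    ∀ᵐ U ∂(labelMeasure G), ∃ y, (cluster U q y).Infinite := by
  classical
  -- at level `1` almost surely all edges are open
  have hone : (1 : ℝ) ∈ {p : ℝ | p ∈ Set.Icc (0 : ℝ) 1 ∧
      ∀ᵐ U ∂(labelMeasure G), ∃ C : (percolation G U p).ConnectedComponent, C.supp.Infinite} := by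
    refine ⟨⟨zero_le_one, le_rfl⟩, ?_⟩
    have h1 : ∀ᵐ U ∂(labelMeasure G), ∀ e : G.edgeSet, (U e : ℝ) ≠ 1 :=
      ae_all_iff.2 fun e => ae_label_ne e (g := fun _ => 1) measurable_const
    filter_upwards [h1] with U hU
    obtain ⟨v⟩ := hconn.nonempty
    refine ⟨(percolation G U 1).connectedComponentMk v, ?_⟩
    rw [supp_connectedComponentMk]
    refine (infinite_of_two hconn U v).mono (reachSet_mono (fun a b hab => ?_) v)
    obtain ⟨hG, -⟩ := percolation_adj.1 hab
    exact percolation_adj.2 ⟨hG, lt_of_le_of_ne (U _).2.2 (hU _)⟩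
  obtain ⟨p, hp, hpq⟩ := exists_lt_of_csInf_lt ⟨1, hone⟩ hq
  filter_upwards [hp.2] with U hU
  obtain ⟨C, hC⟩ := hU
  induction C using SimpleGraph.ConnectedComponent.ind with | _ y =>
  rw [supp_connectedComponentMk] at hC
  exact ⟨y, hC.mono (cluster_mono U hpq.le y)⟩

/-- If there is no percolation at the critical probability, then all ponds are finite. -/
theorem ae_pond_finite [Infinite V] (hconn : G.Connected) (hfin : ∀ v, (G.neighborSet v).Finite)
    (hquasi : IsQuasiTransitive G) (hunim : IsUnimodular G) {o : V}
    (h : theta G (criticalProbability G) o = 0) :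
    ∀ᵐ U ∂(labelMeasure G), ∀ x, (pond U x).Finite := by
  have := countable_of_connected hconn hfin
  have h1 : ∀ᵐ U ∂(labelMeasure G), ∀ q : {q : ℚ // criticalProbability G < q},
      ∃ y, (cluster U (q : ℝ) y).Infinite :=
    ae_all_iff.2 fun q => ae_exists_infinite hconn q.2
  have h2 : ∀ᵐ U ∂(labelMeasure G), ∀ q : {q : ℚ // criticalProbability G < q},
      ∀ l : List G.edgeSet, ∃ U' : Labeling G, (∀ e, e ∉ l → U' e = U e) ∧
        (∀ e ∈ l, (U' e : ℝ) < (q : ℝ)) ∧ IsTame U' :=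
    ae_all_iff.2 fun q => ae_all_iff.2 fun l =>
      ae_exists_lowered (ae_isTame hconn hfin hquasi hunim)
        (criticalProbability_nonneg.trans_lt q.2) l
  filter_upwards [h1, h2, ae_cluster_finite hconn h] with U hU1 hU2 hU3
  intro x
  by_contra hinf
  have hlt : criticalProbability G < bottleneck U x := by
    refine lt_of_le_of_ne (le_bottleneck hconn (hU3 x)) fun heq => hinf ?_
    rw [pond, ← heq]
    exact hU3 x
  obtain ⟨q, hq1, hq2⟩ := exists_rat_btwn hlt
  obtain ⟨q', hq3, hq4⟩ := exists_rat_btwn hq2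
  obtain ⟨y, hy⟩ := hU1 ⟨q, hq1⟩
  obtain ⟨p⟩ := hconn.preconnected x y
  obtain ⟨U', hsame, hlow, hU'⟩ := hU2 ⟨q, hq1⟩ (walkEdges p)
  exact false_of_lowered hconn hfin hU' hq3 hq4 hinf hy p
    (fun e he => hsame e fun h => he (mem_walkEdges.1 h))
    fun e he => hlow e (mem_walkEdges.2 he)

/-! ### One-ended forests -/

/-- A forest in which every vertex has a parent, every edge joins a vertex to its parent, and every
vertex has finitely many descendants has one-ended components: every infinite simple path goes from
parent to parent. -/
theorem card_treeEnd_eq_one {T : SimpleGraph V} {f : V → V} (hadj : ∀ x, T.Adj x (f x))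
    (hcov : ∀ x y, T.Adj x y → f x = y ∨ f y = x)
    (hinj : ∀ x, Function.Injective fun n => f^[n] x)
    (hdesc : ∀ x, {y | ∃ n, f^[n] y = x}.Finite) (C : T.ConnectedComponent) :
    Nat.card (TreeEnd C.toSimpleGraph) = 1 := by
  have hray : ∀ (r : Ray C.toSimpleGraph) n, (r.vert n).1 = f^[n] (r.vert 0).1 := by
    intro r
    have hadjr : ∀ n, T.Adj (r.vert n).1 (r.vert (n + 1)).1 := fun n => r.adj n
    have hforward : ∀ n, f (r.vert n).1 = (r.vert (n + 1)).1 := by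
      intro n
      by_contra hne
      have hback : ∀ k, f (r.vert (n + k + 1)).1 = (r.vert (n + k)).1 := by
        intro k
        induction k with
        | zero => exact (hcov _ _ (hadjr n)).resolve_left hne
        | succ k ih =>
          refine (hcov _ _ (hadjr (n + (k + 1)))).resolve_left fun h => ?_
          have h1 : r.vert (n + k) = r.vert (n + (k + 1) + 1) := Subtype.ext (ih.symm.trans h)
          have := r.injective h1
          omega
      have hdes : ∀ k, f^[k] (r.vert (n + k)).1 = (r.vert n).1 := by
        intro k
        induction k with
        | zero => rfl
        | succ k ih =>
          rw [Function.iterate_succ_apply, ← add_assoc, hback k, ih]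
      have hinf : (Set.range fun k => (r.vert (n + k)).1).Infinite := by
        refine Set.infinite_range_of_injective fun a b hab => ?_
        have := r.injective (Subtype.ext hab)
        omega
      refine hinf ((hdesc (r.vert n).1).subset ?_)
      rintro _ ⟨k, rfl⟩
      exact ⟨k, hdes k⟩
    intro n
    induction n with
    | zero => rfl
    | succ n ih => rw [← hforward, ih, Function.iterate_succ_apply']
  have hmerge : ∀ a b, T.Reachable a b → ∃ i j, f^[i] a = f^[j] b := by
    intro a b hab
    rw [SimpleGraph.reachable_iff_reflTransGen] at hab
    induction hab with
    | refl => exact ⟨0, 0, rfl⟩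
    | @tail b c _ hbc ih =>
      obtain ⟨i, j, hij⟩ := ih
      rcases hcov _ _ hbc with h | h
      · refine ⟨i + 1, j, ?_⟩
        rw [Function.iterate_succ_apply', hij, ← Function.iterate_succ_apply' f,
          Function.iterate_succ_apply, h]
      · refine ⟨i, j + 1, ?_⟩
        rw [Function.iterate_succ_apply, h, hij]
  have hsub : ∀ (r s : Ray C.toSimpleGraph) i j,
      f^[i] (r.vert 0).1 = f^[j] (s.vert 0).1 → (r.support \ s.support).Finite := by
    intro r s i j hij
    refine ((Set.finite_lt_nat i).image r.vert).subset ?_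
    rintro _ ⟨⟨n, rfl⟩, hn⟩
    refine ⟨n, ?_, rfl⟩
    by_contra hin
    obtain ⟨k, rfl⟩ := Nat.exists_eq_add_of_le (not_lt.1 hin)
    refine hn ⟨k + j, Subtype.ext ?_⟩
    rw [hray s, hray r, add_comm i k, Function.iterate_add_apply, Function.iterate_add_apply, hij]
  rw [Nat.card_eq_one_iff_unique]
  constructor
  · constructor
    intro a b
    induction a using Quotient.inductionOn with | _ r =>
    induction b using Quotient.inductionOn with | _ s =>
    refine Quotient.sound ?_
    have hreach : T.Reachable (r.vert 0).1 (s.vert 0).1 :=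
      SimpleGraph.ConnectedComponent.exact ((r.vert 0).2.trans (s.vert 0).2.symm)
    obtain ⟨i, j, hij⟩ := hmerge _ _ hreach
    exact (hsub r s i j hij).union (hsub s r j i hij.symm)
  · induction C using SimpleGraph.ConnectedComponent.ind with | _ x =>
    have hmem : ∀ n, f^[n] x ∈ (T.connectedComponentMk x).supp := by
      intro n
      induction n with
      | zero => rfl
      | succ n ih =>
        rw [Function.iterate_succ_apply']
        rw [SimpleGraph.ConnectedComponent.mem_supp_iff] at ih ⊢
        rw [← ih]
        exact SimpleGraph.ConnectedComponent.sound (hadj _).symm.reachable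
    refine ⟨Quotient.mk _ ⟨fun n => ⟨f^[n] x, hmem n⟩, fun m n h => ?_, fun n => ?_⟩⟩
    · exact hinj x (congrArg Subtype.val h)
    · show T.Adj (f^[n] x) (f^[n + 1] x)
      rw [Function.iterate_succ_apply']
      exact hadj _

/-! ### The parent map of the wired forest -/

theorem isOutlet_congr [Infinite V] (hconn : G.Connected) {U : Labeling G} {x y a b : V}
    (h : y ∈ pond U x) : IsOutlet U y a b ↔ IsOutlet U x a b := by
  rw [IsOutlet, IsOutlet, pond_eq hconn h, bottleneck_eq_of_mem_pond hconn h]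

/-- If all ponds are finite, then the parent of a vertex is the next vertex on its way to the
outlet of its pond, or the other endpoint of the outlet. Every forest edge joins a vertex to its
parent. -/
theorem exists_parent [Infinite V] (hconn : G.Connected) (hfin : ∀ v, (G.neighborSet v).Finite)
    {U : Labeling G} (hU : IsGeneric U) (hpond : ∀ x, (pond U x).Finite) :
    ∃ f : V → V, (∀ x, (wiredForest G U).Adj x (f x)) ∧
      (∀ x y, (wiredForest G U).Adj x y → f x = y ∨ f y = x) ∧
      (∀ x, Function.Injective fun n => f^[n] x) ∧
      ∀ x, f x ∈ pond U x ∨ PondStep U x (f x) := by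
  classical
  set T := wiredForest G U with hT
  have hac : T.IsAcyclic := wiredForest_isAcyclic hfin hU.injective
  have hout : ∀ x, ∃ u w, IsOutlet U x u w := fun x => by
    obtain ⟨u, w, hu, hw, h⟩ := exists_outlet hconn hfin (hpond x)
    exact ⟨u, w, hu, hw, h⟩
  choose root exit hroot using hout
  have huniq : ∀ x a b, IsOutlet U x a b → root x = a ∧ exit x = b := by
    rintro x a b ⟨ha, hb, h, he⟩
    obtain ⟨h1, -, h3, h4⟩ := hroot x
    exact eq_of_outlet hU.injective h1 ha hb (h4.trans he.symm)
  have hroot_eq : ∀ x y, y ∈ pond U x → root y = root x := fun x y hy =>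
    (huniq y _ _ ((isOutlet_congr hconn hy).2 (hroot x))).1
  -- a forest path from `x` to the outlet of its pond, inside the pond
  have hpath : ∀ x, ∃ p : T.Walk x (root x), p.IsPath ∧ ∀ v ∈ p.support, v ∈ pond U x := by
    intro x
    obtain ⟨p, hp⟩ := (reachable_wiredForest_of_finite hfin (hpond x) (hroot x).1).exists_isPath
    refine ⟨p.mapLe inf_le_left, (SimpleGraph.Walk.isPath_mapLe _).2 hp, fun v hv => ?_⟩
    rw [SimpleGraph.Walk.support_mapLe_eq_support] at hv
    exact SimpleGraph.Reachable.mono inf_le_right (p.takeUntil v hv).reachable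
  choose p hp hpp using hpath
  have hpuniq : ∀ x (r : T.Walk x (root x)), r.IsPath → r = p x := fun x r hr =>
    congrArg Subtype.val ((hac.subsingleton_path _ _).elim ⟨r, hr⟩ ⟨p x, hp x⟩)
  let f : V → V := fun x => if x = root x then exit x else (p x).snd
  have hfroot : ∀ x, x = root x → f x = exit x := fun x h => if_pos h
  have hfnot : ∀ x, x ≠ root x → f x = (p x).snd := fun x h => if_neg h
  have hnil : ∀ x, x ≠ root x → ¬(p x).Nil := fun x h hn => h hn.eq
  have hinside : ∀ x, x ≠ root x → f x ∈ pond U x := fun x h => by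
    rw [hfnot x h]
    exact hpp x _ ((p x).getVert_mem_support 1)
  -- the length of the path decreases along `f`
  have hlen : ∀ x, x ≠ root x → (p (f x)).length < (p x).length := by
    intro x h
    have h1 : root (f x) = root x := hroot_eq x (f x) (hinside x h)
    have h2 : ((p x).tail.copy (hfnot x h).symm h1.symm) = p (f x) :=
      hpuniq (f x) _ ((SimpleGraph.Walk.isPath_copy _ _ _).2 (hp x).tail)
    rw [← h2, SimpleGraph.Walk.length_copy]
    have := SimpleGraph.Walk.length_tail_add_one (hnil x h)
    omega
  have hstep : ∀ x, x = root x → PondStep U x (f x) := fun x h => by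
    rw [hfroot x h]
    obtain ⟨h1, h2, h3⟩ := hroot x
    exact ⟨_, h1, h2, h3⟩
  refine ⟨f, fun x => ?_, fun x y hxy => ?_, fun x => ?_, fun x => ?_⟩
  · by_cases h : x = root x
    · rw [hfroot x h]
      obtain ⟨h1, h2, h3, h4⟩ := hroot x
      have := wiredForest_adj_of_outlet hfin (hpond x) h1 h2 h3 h4
      rwa [← h] at this
    · rw [hfnot x h]
      exact (p x).adj_snd (hnil x h)
  · by_cases hy : y ∈ pond U x
    · have hrr := hroot_eq x y hy
      by_cases hys : y ∈ (p x).support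
      · left
        have hx : x ≠ root x := by
          intro h
          have h1 : (p x).IsPath := hp x
          have h2 : (p x).Nil := by
            have h3 := hpuniq x (SimpleGraph.Walk.nil.copy rfl h) (by
              rw [SimpleGraph.Walk.isPath_copy]; exact SimpleGraph.Walk.IsPath.nil)
            rw [← SimpleGraph.Walk.length_eq_zero_iff, ← h3, SimpleGraph.Walk.length_copy]
            rfl
          rw [SimpleGraph.Walk.nil_iff_support_eq.1 h2, List.mem_singleton] at hys
          exact hxy.ne hys.symm
        rw [hfnot x hx]
        exact (hac.eq_snd_of_adj_start (hp x) hxy hys).symm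
      · right
        have hc : (SimpleGraph.Walk.cons hxy.symm (p x)).IsPath :=
          (SimpleGraph.Walk.cons_isPath_iff _ _).2 ⟨hp x, hys⟩
        have h2 := hpuniq y ((SimpleGraph.Walk.cons hxy.symm (p x)).copy rfl hrr.symm)
          ((SimpleGraph.Walk.isPath_copy _ _ _).2 hc)
        have hy' : y ≠ root y := by
          intro h
          rw [hrr] at h
          exact hys (h ▸ (p x).end_mem_support)
        rw [hfnot y hy', ← h2, SimpleGraph.Walk.snd, SimpleGraph.Walk.getVert_copy]
        exact SimpleGraph.Walk.snd_cons _ _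
    · have hG := wiredForest_le U hxy
      have hx : x ∉ pond U y := fun h => hy (by rw [pond_eq hconn h]; exact mem_pond_self U y)
      rcases outlet_or_outlet hconn hfin hxy hy with he | he
      · left
        obtain ⟨h1, h2⟩ := huniq x x y ⟨mem_pond_self U x, hy, hG, he⟩
        rw [hfroot x h1.symm, h2]
      · right
        obtain ⟨h1, h2⟩ := huniq y y x ⟨mem_pond_self U y, hx, hG.symm, by
          simpa only [Sym2.eq_swap] using he⟩
        rw [hfroot y h1.symm, h2]
  · -- bottleneck and path length decrease lexicographically
    let R : V → V → Prop := fun a b => bottleneck U b < bottleneck U a ∨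
      (bottleneck U b = bottleneck U a ∧ (p b).length < (p a).length)
    have hRf : ∀ a, R a (f a) := by
      intro a
      by_cases h : a = root a
      · exact Or.inl ((hstep a h).bottleneck_lt hconn hfin hU (hpond a))
      · exact Or.inr ⟨bottleneck_eq_of_mem_pond hconn (hinside a h), hlen a h⟩
    have hRt : ∀ a b c, R a b → R b c → R a c := by
      rintro a b c (h1 | ⟨h1, h1'⟩) (h2 | ⟨h2, h2'⟩)
      · exact Or.inl (h2.trans h1)
      · exact Or.inl (h2 ▸ h1)
      · exact Or.inl (h1 ▸ h2)
      · exact Or.inr ⟨h2.trans h1, h2'.trans h1'⟩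
    have hRn : ∀ a k, R a (f^[k + 1] a) := by
      intro a k
      induction k with
      | zero => exact hRf a
      | succ k ih =>
        rw [Function.iterate_succ_apply']
        exact hRt _ _ _ ih (hRf _)
    have hne : ∀ m k, f^[m] x ≠ f^[m + k + 1] x := by
      intro m k h
      have h1 := hRn (f^[m] x) k
      rw [← Function.iterate_add_apply, show k + 1 + m = m + k + 1 by omega, ← h] at h1
      rcases h1 with h1 | h1
      · exact lt_irrefl _ h1
      · exact lt_irrefl _ h1.2
    intro m n hmn
    rcases lt_trichotomy m n with h | h | h
    · obtain ⟨k, rfl⟩ := Nat.exists_eq_add_of_lt h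
      exact absurd hmn (hne m k)
    · exact h
    · obtain ⟨k, rfl⟩ := Nat.exists_eq_add_of_lt h
      exact absurd hmn.symm (hne n k)
  · by_cases h : x = root x
    · exact Or.inr (hstep x h)
    · exact Or.inl (hinside x h)

/-- Only finitely many vertices flow through the outlets of successive ponds into a given vertex:
before the last step they all lie above a level separating the bottlenecks of two adjacent
vertices. -/
theorem finite_flow [Infinite V] (hconn : G.Connected) (hfin : ∀ v, (G.neighborSet v).Finite)
    {U : Labeling G} (hU : IsTame U) (hpond : ∀ x, (pond U x).Finite) (w : V) :
    {y | ∃ v, Relation.ReflTransGen (PondStep U) y v ∧ PondStep U v w}.Finite := by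
  have hq : ∀ u, ∃ q : ℚ, bottleneck U w < bottleneck U u →
      bottleneck U w < q ∧ (q : ℝ) < bottleneck U u := by
    intro u
    by_cases h : bottleneck U w < bottleneck U u
    · obtain ⟨q, hq⟩ := exists_rat_btwn h
      exact ⟨q, fun _ => hq⟩
    · exact ⟨0, fun h' => absurd h' h⟩
  choose q hq using hq
  refine ((hfin w).biUnion fun u _ => hU.finite_crosses (q u) w).subset ?_
  rintro y ⟨v, hyv, hvw⟩
  have hlt := hvw.bottleneck_lt hconn hfin hU.toIsGeneric (hpond v)
  obtain ⟨u, hu, -, hG, -⟩ := id hvw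
  have hZ := bottleneck_eq_of_mem_pond hconn hu
  obtain ⟨h1, h2⟩ := hq u (by rw [hZ]; exact hlt)
  refine Set.mem_biUnion (x := u) hG.symm ⟨?_, h1⟩
  have habove : Relation.ReflTransGen (StepAbove (q u) U) y v ∧ (q u : ℝ) ≤ bottleneck U y := by
    induction hyv using Relation.ReflTransGen.head_induction_on with
    | refl => exact ⟨.refl, by rw [← hZ]; exact h2.le⟩
    | @head a b hab _ ih =>
      have h3 := hab.bottleneck_lt hconn hfin hU.toIsGeneric (hpond a)
      have h4 : (q u : ℝ) ≤ bottleneck U a := ih.2.trans h3.le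
      exact ⟨.head ⟨hab, h4⟩ ih.1, h4⟩
  exact habove.1.tail ⟨hvw, by rw [← hZ]; exact h2.le⟩

/-- If the labeling is tame and all ponds are finite, the forest components have one end. -/
theorem card_treeEnd_wiredForest [Infinite V] (hconn : G.Connected)
    (hfin : ∀ v, (G.neighborSet v).Finite) {U : Labeling G} (hU : IsTame U)
    (hpond : ∀ x, (pond U x).Finite) (C : (wiredForest G U).ConnectedComponent) :
    Nat.card (TreeEnd C.toSimpleGraph) = 1 := by
  obtain ⟨f, hadj, hcov, hinj, hstep⟩ := exists_parent hconn hfin hU.toIsGeneric hpond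
  refine card_treeEnd_eq_one hadj hcov hinj (fun x => ?_) C
  refine ((hpond x).union ((hpond x).biUnion fun w _ =>
    finite_flow hconn hfin hU hpond w)).subset ?_
  rintro y ⟨n, hn⟩
  induction n generalizing y with
  | zero => exact Or.inl (by rw [show y = x from hn]; exact mem_pond_self U x)
  | succ n ih =>
    have ih' := ih (y := f y) (by rwa [Function.iterate_succ_apply] at hn)
    simp only [Set.mem_union, Set.mem_iUnion, Set.mem_ofPred_eq, exists_prop] at ih' ⊢
    rcases hstep y with hy | hy
    · have hy' : y ∈ pond U (f y) := by rw [pond_eq hconn hy]; exact mem_pond_self U y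
      rcases ih' with h | ⟨w, hw, v, hv, hvw⟩
      · left
        rw [← pond_eq hconn h]
        exact hy'
      · right
        refine ⟨w, hw, ?_⟩
        rcases Relation.ReflTransGen.cases_head hv with rfl | ⟨z, hz, hzv⟩
        · exact ⟨y, .refl, (pondStep_congr hconn hy).1 hvw⟩
        · exact ⟨v, .head ((pondStep_congr hconn hy).1 hz) hzv, hvw⟩
    · right
      rcases ih' with h | ⟨w, hw, v, hv, hvw⟩
      · exact ⟨f y, h, y, .refl, hy⟩
      · exact ⟨w, hw, v, .head hy hv, hvw⟩

end MinimalForest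

end

theorem theorem1p1 {V : Type*} [Infinite V] (G : SimpleGraph V)
    (hconn : G.Connected) (hfin : ∀ v : V, (G.neighborSet v).Finite)
    (hquasi : MinimalForest.IsQuasiTransitive G) (hunim : MinimalForest.IsUnimodular G) :
    (MinimalForest.IsTransitive G → ∀ x : V, MinimalForest.wiredExpectedDegree G x = 2) ∧
    (∀ o : V, MinimalForest.theta G (MinimalForest.criticalProbability G) o = 0 →
      ∀ᵐ U ∂(MinimalForest.labelMeasure G),
        ∀ C : (MinimalForest.wiredForest G U).ConnectedComponent,
          Nat.card (MinimalForest.TreeEnd C.toSimpleGraph) = 1) := by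
  refine ⟨fun htrans x => MinimalForest.wiredExpectedDegree_eq_two hconn hfin hunim htrans x,
    fun o ho => ?_⟩
  filter_upwards [MinimalForest.ae_isTame hconn hfin hquasi hunim,
    MinimalForest.ae_pond_finite hconn hfin hquasi hunim ho] with U hU hpond
  exact MinimalForest.card_treeEnd_wiredForest hconn hfin hU hpond
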